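/- Write $\log x = \log_2(x+2)$. Consider the word RAM in which words have $b$ bits, where $b$ is at least a sufficiently large constant times $\log U$, and in which each arithmetic or bitwise operation on words, each comparison and each memory access takes one step. There are a fixed query program and absolute constants (independent of $U$, $b$, $\epsilon$, the set and the weights below) such that the following holds. Let $\mathcal U=\{0,1,\dots,U-1\}$, let $S\subseteq\mathcal U$ be a static set of $n$ elements, let $0<\epsilon<1$, let each $i\in\mathcal U$ have a real weight $w_i>0$, and let $W=\sum_{i=0}^{U-1}w_i$. Then there is a static data structure that occupies $O\bigl(n+2^{(\log U)^{\epsilon}}\bigr)$ words and on which the query program, given any $i\in\mathcal U$, finds the predecessor of $i$ in $S$, or reports that there is none, in worst-case time $O\bigl(\tfrac1\epsilon\log\log(W/w_i)\bigr)$. This holds both when the predecessor of $i$ means the largest element of $S$ smaller than $i$, and when it means the largest element of $S$ that is at most $i$ (with a program for each of the two meanings). -/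

import Mathlib

/-- The logarithm `log x = log₂ (x + 2)`. -/
noncomputable def lg (x : ℝ) : ℝ := Real.logb 2 (x + 2)

/-!
A word RAM that queries a static data structure.

Words are bit vectors of length `b`. The data structure is a list of words, which a query can read
by random access but cannot change. A query program is a fixed finite piece of code, the same for
all word lengths and all data structures, and works on finitely many registers, each holding one
word. Every arithmetic or bitwise operation on words, every load of a cell, every loading of a
constant and every evaluation of a test takes one step.
-/

namespace WordRAM

/-- The operations of the machine on words. -/
inductive Op where
  | add | sub | mul | div | mod | shl | shr | and | or | xor

/-- The operations act on words as usual: arithmetic is unsigned and modulo `2 ^ b`,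
division is the integer division, and shifts fill up with zeros. -/
def Op.eval {b : ℕ} : Op → BitVec b → BitVec b → BitVec b
  | .add, x, y => x + y
  | .sub, x, y => x - y
  | .mul, x, y => x * y
  | .div, x, y => x / y
  | .mod, x, y => x % y
  | .shl, x, y => x <<< y
  | .shr, x, y => x >>> y
  | .and, x, y => x &&& y
  | .or, x, y => x ||| y
  | .xor, x, y => x ^^^ y

/-- The contents of the registers. -/
abbrev Regs (b : ℕ) : Type := ℕ → BitVec b

/-- Comparisons of two registers. -/
inductive Test where
  | lt (x y : ℕ)
  | eq (x y : ℕ)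

/-- The truth value of a comparison; `lt` compares words as unsigned integers. -/
def Test.Holds {b : ℕ} (σ : Regs b) : Test → Prop
  | .lt x y => (σ x).toNat < (σ y).toNat
  | .eq x y => σ x = σ y

/-- Query programs. The numbers `d`, `x`, `y` are names of registers. -/
inductive Program where
  /-- Do nothing. -/
  | nop
  /-- Put the constant `v` (modulo `2 ^ b`) into register `d`. -/
  | const (d v : ℕ)
  /-- Put the result of an operation on the registers `x` and `y` into register `d`. -/
  | op (o : Op) (d x y : ℕ)
  /-- Put the memory cell whose address is in register `x` into register `d`. -/
  | load (d x : ℕ)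
  /-- Run `p`, then `q`. -/
  | seq (p q : Program)
  /-- Run `p` if the test holds, and `q` otherwise. -/
  | cond (t : Test) (p q : Program)
  /-- Run `p` as long as the test holds. -/
  | loop (t : Test) (p : Program)

/-- `Exec M p σ t τ` says that the program `p`, started with register contents `σ` on the data
structure `M`, terminates after exactly `t` steps with register contents `τ`. A program that tries
to read a cell outside `M` gets stuck and does not terminate. -/
inductive Exec {b : ℕ} (M : List (BitVec b)) : Program → Regs b → ℕ → Regs b → Prop where
  | nop (σ : Regs b) : Exec M .nop σ 1 σ
  | const (σ : Regs b) (d v : ℕ) :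
      Exec M (.const d v) σ 1 (Function.update σ d (BitVec.ofNat b v))
  | op (σ : Regs b) (o : Op) (d x y : ℕ) :
      Exec M (.op o d x y) σ 1 (Function.update σ d (o.eval (σ x) (σ y)))
  | load (σ : Regs b) (d x : ℕ) (v : BitVec b) (h : M[(σ x).toNat]? = some v) :
      Exec M (.load d x) σ 1 (Function.update σ d v)
  | seq {p q : Program} {σ₁ σ₂ σ₃ : Regs b} {t₁ t₂ : ℕ}
      (h₁ : Exec M p σ₁ t₁ σ₂) (h₂ : Exec M q σ₂ t₂ σ₃) :
      Exec M (.seq p q) σ₁ (t₁ + t₂) σ₃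
  | cond_true {c : Test} {p q : Program} {σ τ : Regs b} {t : ℕ}
      (hc : c.Holds σ) (h : Exec M p σ t τ) : Exec M (.cond c p q) σ (t + 1) τ
  | cond_false {c : Test} {p q : Program} {σ τ : Regs b} {t : ℕ}
      (hc : ¬ c.Holds σ) (h : Exec M q σ t τ) : Exec M (.cond c p q) σ (t + 1) τ
  | loop_true {c : Test} {p : Program} {σ₁ σ₂ σ₃ : Regs b} {t₁ t₂ : ℕ}
      (hc : c.Holds σ₁) (h₁ : Exec M p σ₁ t₁ σ₂) (h₂ : Exec M (.loop c p) σ₂ t₂ σ₃) :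
      Exec M (.loop c p) σ₁ (t₁ + t₂ + 1) σ₃
  | loop_false {c : Test} {p : Program} {σ : Regs b}
      (hc : ¬ c.Holds σ) : Exec M (.loop c p) σ 1 σ

/-- The machine is deterministic: result and number of steps are unique. -/
theorem Exec.unique {b : ℕ} {M : List (BitVec b)} {p : Program} {σ τ τ' : Regs b} {t t' : ℕ}
    (h : Exec M p σ t τ) (h' : Exec M p σ t' τ') : t = t' ∧ τ = τ' := by
  induction h generalizing t' τ' with
  | nop | const | op => cases h'; exact ⟨rfl, rfl⟩
  | load σ d x v h => cases h' with
    | load _ _ _ v' h' => simp_all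
  | seq _ _ ih₁ ih₂ => cases h' with
    | seq k₁ k₂ =>
      obtain ⟨rfl, rfl⟩ := ih₁ k₁
      obtain ⟨rfl, rfl⟩ := ih₂ k₂
      exact ⟨rfl, rfl⟩
  | cond_true hc _ ih => cases h' with
    | cond_true _ k => obtain ⟨rfl, rfl⟩ := ih k; exact ⟨rfl, rfl⟩
    | cond_false hn _ => exact absurd hc hn
  | cond_false hc _ ih => cases h' with
    | cond_true hn _ => exact absurd hn hc
    | cond_false _ k => obtain ⟨rfl, rfl⟩ := ih k; exact ⟨rfl, rfl⟩
  | loop_true hc _ _ ih₁ ih₂ => cases h' with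
    | loop_true _ k₁ k₂ =>
      obtain ⟨rfl, rfl⟩ := ih₁ k₁
      obtain ⟨rfl, rfl⟩ := ih₂ k₂
      exact ⟨rfl, rfl⟩
    | loop_false hn => exact absurd hc hn
  | loop_false hc => cases h' with
    | loop_true hn _ _ => exact absurd hn hc
    | loop_false _ => exact ⟨rfl, rfl⟩

/-- The initial registers for the query `i`: register `0` holds `i`, all others hold `0`. -/
def init (b i : ℕ) : Regs b := fun r => if r = 0 then BitVec.ofNat b i else 0#b

/-- The final registers `τ` report the answer `a` to a predecessor query: register `0` is `0` if
there is no predecessor, and otherwise register `0` is `1` and register `1` holds the predecessor. -/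
def Reports {b U : ℕ} (τ : Regs b) : WithBot (Fin U) → Prop
  | ⊥ => (τ 0).toNat = 0
  | (s : Fin U) => (τ 0).toNat = 1 ∧ (τ 1).toNat = (s : ℕ)

end WordRAM

/-- The predecessor of `i` in `S`, or `⊥` if there is none: the largest element of `S` that is
smaller than `i` (if `strict` is true) or at most `i` (if `strict` is false). -/
def predecessor (strict : Bool) {U : ℕ} (S : Finset (Fin U)) (i : Fin U) : WithBot (Fin U) :=
  if strict then (S.filter (fun s => s < i)).max else (S.filter (fun s => s ≤ i)).max

/-! ### Perfect hashing -/

/-! Let `B = 2 ^ (lg U ^ ε)` and call `i` heavy if `W / w i ≤ B`. The weights of the heavy points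
add up to at most `W`, so there are at most `B` of them (`card_heavy_le`). Their answers are stored
in a hash table and found in constant time. For a light `i`, taking logarithms twice in `W / w i >
B` gives `log log U ≤ (1 / ε) log log (W / w i)` (`logb_lg_le_of_light`), so a search in `O(log log
U)` steps is affordable.

That search computes the rank of `j`, the number of elements of `S` below `j`, where `j` is `i` or
`i + 1`. Let `L` be the bit length of `U`. The coarse rank `⌊rank / L⌋` is a step function with at
most `n / L` jumps, so the trie of all prefixes of its jump points has only `O(n)` nodes. The node
at which `j` leaves this trie determines the coarse rank of `j` (`eq_of_same_exit`), so the coarse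
rank can be stored there (`exists_trie_values`). A binary search over the `L + 1` prefix lengths
finds the exit node. The coarse rank confines the rank to a window of length `L`, and a second
binary search, in the sorted list of `S`, finds it. Both take `O(log L)` rounds (`does_bsearch`).

Trie nodes and heavy points share one two-level hash table of linear size (`exists_perfect_hash`).
`does_query` verifies the program and `exists_structure` builds the memory. -/

/-- If `a` makes `x` and `y` collide, the difference `d a` of the two residues is a nonzero multiple
of `m` of size at most `p - 1`, which leaves at most `2 * ((p - 1) / m)` values. Since `d a ≡ a * (x
- y)` modulo `p`, the difference determines `a`. -/
theorem card_multipliers_collide_le {p : ℕ} (hp : p.Prime) {x y m : ℕ} (hx : x < p) (hy : y < p)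
    (hxy : x ≠ y) (hm : 0 < m) :
    ((Finset.Ico 1 p).filter fun a => a * x % p % m = a * y % p % m).card * m ≤ 2 * (p - 1) := by
  have hp0 : 0 < p := hp.pos
  have hpz : Prime (p : ℤ) := Nat.prime_iff_prime_int.mp hp
  set A := (Finset.Ico 1 p).filter fun a => a * x % p % m = a * y % p % m with hA
  set q := (p - 1) / m with hq
  let d : ℕ → ℤ := fun a => ((a * x % p : ℕ) : ℤ) - ((a * y % p : ℕ) : ℤ)
  have hmod : ∀ a, (p : ℤ) ∣ d a - a * ((x : ℤ) - y) := by
    intro a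
    have h1 : (p : ℤ) ∣ ((a * x % p : ℕ) : ℤ) - a * x := by
      push_cast; exact (Int.mod_modEq _ _).symm.dvd
    have h2 : (p : ℤ) ∣ ((a * y % p : ℕ) : ℤ) - a * y := by
      push_cast; exact (Int.mod_modEq _ _).symm.dvd
    have := dvd_sub h1 h2
    have e : d a - a * ((x : ℤ) - y) =
        ((a * x % p : ℕ) : ℤ) - a * x - (((a * y % p : ℕ) : ℤ) - a * y) := by
      simp only [d]; ring
    rwa [e]
  have hsmall : ∀ z : ℤ, (p : ℤ) ∣ z → |z| < p → z = 0 :=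
    fun z h1 h2 => Int.eq_zero_of_abs_lt_dvd h1 h2
  have hxy' : ¬ (p : ℤ) ∣ (x : ℤ) - y := by
    intro h
    have := hsmall _ h (by rw [abs_lt]; constructor <;> omega)
    omega
  have hdvd : ∀ a ∈ A, (m : ℤ) ∣ d a := by
    intro a ha
    have h := (Finset.mem_filter.mp ha).2
    exact (Nat.modEq_iff_dvd.mp (show a * y % p ≡ a * x % p [MOD m] from h.symm))
  have hmap : ∀ a ∈ A, d a / m ∈ (Finset.Icc (-(q : ℤ)) q).erase 0 := by
    intro a ha
    have ha1 := Finset.mem_Ico.mp (Finset.mem_filter.mp ha).1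
    obtain ⟨z, hz⟩ := hdvd a ha
    have hm' : (0 : ℤ) < m := by exact_mod_cast hm
    have hdz : d a / m = z := by rw [hz]; exact Int.mul_ediv_cancel_left _ hm'.ne'
    have h1 := Nat.mod_lt (a * x) hp0
    have h2 := Nat.mod_lt (a * y) hp0
    have hub : (m : ℤ) * z ≤ (p - 1 : ℕ) := by rw [← hz]; simp only [d]; omega
    have hlb : (m : ℤ) * -z ≤ (p - 1 : ℕ) := by rw [mul_neg, ← hz]; simp only [d]; omega
    have hqz : ∀ z : ℤ, (m : ℤ) * z ≤ (p - 1 : ℕ) → z ≤ q := by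
      intro z h
      rw [hq, Int.natCast_ediv]
      exact (Int.le_ediv_iff_mul_le hm').mpr (by rwa [mul_comm])
    rw [Finset.mem_erase, Finset.mem_Icc, hdz]
    refine ⟨?_, by have := hqz _ hlb; omega, hqz _ hub⟩
    -- Equal residues would make `p` divide `a * (x - y)`, although `0 < a < p` and `x`, `y` are
    -- distinct modulo `p`.
    rintro rfl
    have h0 : d a = 0 := by simp [hz]
    have h3 := hmod a
    rw [h0, zero_sub, dvd_neg] at h3
    rcases hpz.dvd_or_dvd h3 with h | h
    · have := Int.le_of_dvd (by omega) h
      omega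
    · exact hxy' h
  have hinj : Set.InjOn (fun a => d a / m) A := by
    intro a ha a' ha' h
    have h' : d a = d a' := by
      rw [← Int.ediv_mul_cancel (hdvd a ha), ← Int.ediv_mul_cancel (hdvd a' ha')]
      exact congrArg (· * (m : ℤ)) h
    have h1 := dvd_sub (hmod a') (hmod a)
    have h2 : (p : ℤ) ∣ ((a : ℤ) - a') * (x - y) := by
      have e : d a' - a' * ((x : ℤ) - y) - (d a - a * ((x : ℤ) - y)) =
          ((a : ℤ) - a') * (x - y) := by rw [h']; ring
      rwa [e] at h1
    have b1 := Finset.mem_Ico.mp (Finset.mem_filter.mp ha).1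
    have b2 := Finset.mem_Ico.mp (Finset.mem_filter.mp ha').1
    rcases hpz.dvd_or_dvd h2 with h | h
    · have := hsmall _ h (by rw [abs_lt]; constructor <;> omega)
      omega
    · exact absurd h hxy'
  have hcard := Finset.card_le_card_of_injOn _ hmap hinj
  rw [Finset.card_erase_of_mem (by simp), Int.card_Icc] at hcard
  have hc : A.card ≤ 2 * q := by omega
  calc A.card * m ≤ 2 * q * m := Nat.mul_le_mul_right _ hc
    _ = 2 * (q * m) := by ring
    _ ≤ 2 * (p - 1) := Nat.mul_le_mul_left _ (Nat.div_mul_le_self _ _)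

/-- Averaging over all multipliers: some `a` does at least as well as the mean of the pairwise
collision bounds. -/
theorem exists_multiplier {p : ℕ} (hp : p.Prime) (K : Finset ℕ) (hK : ∀ x ∈ K, x < p) {m : ℕ}
    (hm : 0 < m) :
    ∃ a < p, (K.offDiag.filter fun z => a * z.1 % p % m = a * z.2 % p % m).card * m
      ≤ 2 * K.offDiag.card := by
  have hp1 := hp.one_lt
  have hne : (Finset.Ico 1 p).Nonempty := ⟨1, by simp [hp1]⟩
  obtain ⟨a, ha, h⟩ := Finset.exists_le_of_sum_le (s := Finset.Ico 1 p)
    (f := fun a => (K.offDiag.filter fun z => a * z.1 % p % m = a * z.2 % p % m).card * m)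
    (g := fun _ => 2 * K.offDiag.card) hne (by
      simp only [Finset.card_filter, Finset.sum_mul]
      rw [Finset.sum_comm]
      calc _ ≤ ∑ z ∈ K.offDiag, 2 * (p - 1) := by
            refine Finset.sum_le_sum fun z hz => ?_
            rw [Finset.mem_offDiag] at hz
            rw [← Finset.sum_mul, ← Finset.card_filter]
            exact card_multipliers_collide_le hp (hK _ hz.1) (hK _ hz.2.1) hz.2.2 hm
        _ = _ := by simp; ring)
  exact ⟨a, (Finset.mem_Ico.mp ha).2, h⟩

/-- The address of the key `x` in a two-level hash table. -/
def hashSlot (p N a : ℕ) (mult off md : ℕ → ℕ) (x : ℕ) : ℕ :=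
  mult (a * x % p % N) * x % p % md (a * x % p % N) + off (a * x % p % N)

/-- The scheme of Fredman, Komlós and Szemerédi. With `N` buckets there are at most `2 * N`
colliding ordered pairs. A bucket with `c` such pairs gets `2 * c + 1` cells, in which the expected
number of collisions is below one, so some multiplier has none. In total this takes at most `2 * (2
* N) + N` cells. -/
theorem exists_perfect_hash {p : ℕ} (hp : p.Prime) (K : Finset ℕ) (hK : ∀ x ∈ K, x < p)
    (hne : K.Nonempty) :
    ∃ (a : ℕ) (mult off md : ℕ → ℕ), a < p ∧ (∀ h, mult h < p) ∧ (∀ h, 0 < md h) ∧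
      (∀ h < K.card, off h + md h ≤ 5 * K.card) ∧
      Set.InjOn (hashSlot p K.card a mult off md) K := by
  set N := K.card with hN
  have hN0 : 0 < N := hne.card_pos
  obtain ⟨a, hap, ha⟩ := exists_multiplier hp K hK hN0
  let B : ℕ → Finset ℕ := fun h => K.filter fun x => a * x % p % N = h
  let md : ℕ → ℕ := fun h => 2 * (B h).offDiag.card + 1
  have hmd : ∀ h, 0 < md h := fun h => Nat.succ_pos _
  have hsecond : ∀ h, ∃ a' < p,
      ((B h).offDiag.filter fun z => a' * z.1 % p % md h = a' * z.2 % p % md h).card * md h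
        ≤ 2 * (B h).offDiag.card := fun h =>
    exists_multiplier hp (B h) (fun x hx => hK x (Finset.mem_filter.mp hx).1) (hmd h)
  choose mult hmult hcoll using hsecond
  let off : ℕ → ℕ := fun h => ∑ h' ∈ Finset.range h, md h'
  have hoff : ∀ h h', h < h' → off h + md h ≤ off h' := by
    intro h h' hlt
    rw [← Finset.sum_range_succ]
    exact Finset.sum_le_sum_of_subset (Finset.range_mono hlt)
  have htotal : off N ≤ 5 * N := by
    have h1 : ∑ h ∈ Finset.range N, (B h).offDiag.card =
        (K.offDiag.filter fun z => a * z.1 % p % N = a * z.2 % p % N).card := by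
      rw [Finset.card_eq_sum_card_fiberwise (t := Finset.range N)
        (f := fun z => a * z.1 % p % N)
        (fun z _ => by simpa using Nat.mod_lt _ hN0)]
      refine Finset.sum_congr rfl fun h _ => congrArg Finset.card ?_
      ext z
      simp only [B, Finset.mem_offDiag, Finset.mem_filter]
      constructor
      · rintro ⟨⟨h1, h2⟩, ⟨h3, h4⟩, h5⟩
        exact ⟨⟨⟨h1, h3, h5⟩, h2.trans h4.symm⟩, h2⟩
      · rintro ⟨⟨⟨h1, h3, h5⟩, h2⟩, h4⟩
        exact ⟨⟨h1, h4⟩, ⟨h3, h2 ▸ h4⟩, h5⟩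
    have h2 : off N = 2 * (∑ h ∈ Finset.range N, (B h).offDiag.card) + N := by
      simp [off, md, Finset.sum_add_distrib, Finset.mul_sum]
    rw [← h1, Finset.offDiag_card] at ha
    have h3 : (∑ h ∈ Finset.range N, (B h).offDiag.card) * N ≤ (2 * N) * N := by
      refine ha.trans ?_
      rw [← hN, mul_assoc]
      exact Nat.mul_le_mul_left _ (Nat.sub_le _ _)
    have := Nat.le_of_mul_le_mul_right h3 hN0
    omega
  refine ⟨a, mult, off, md, hap, hmult, hmd, fun h hh => (hoff h N hh).trans htotal, ?_⟩
  intro x hx y hy hxy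
  simp only [hashSlot] at hxy
  have hlt : ∀ x, mult (a * x % p % N) * x % p % md (a * x % p % N) < md (a * x % p % N) :=
    fun x => Nat.mod_lt _ (hmd _)
  have hb : a * x % p % N = a * y % p % N := by
    rcases lt_trichotomy (a * x % p % N) (a * y % p % N) with h | h | h
    · have := hoff _ _ h; have := hlt x; omega
    · exact h
    · have := hoff _ _ h; have := hlt y; omega
  by_contra hne'
  rw [← hb] at hxy
  have hpos : 0 < ((B (a * x % p % N)).offDiag.filter fun z =>
      mult (a * x % p % N) * z.1 % p % md (a * x % p % N) =
      mult (a * x % p % N) * z.2 % p % md (a * x % p % N)).card := by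
    refine Finset.card_pos.mpr ⟨(x, y), ?_⟩
    refine Finset.mem_filter.mpr ⟨Finset.mem_offDiag.mpr ⟨?_, ?_, hne'⟩,
      Nat.add_right_cancel hxy⟩
    · exact Finset.mem_filter.mpr ⟨hx, rfl⟩
    · exact Finset.mem_filter.mpr ⟨hy, hb.symm⟩
  have h1 := hcoll (a * x % p % N)
  have h2 := Nat.mul_le_mul_right (md (a * x % p % N)) hpos
  simp only [md] at h1 h2
  omega

namespace WordRAM

/-! ### Reasoning about programs -/

/-- Register contents given by natural numbers. -/
def enc (b : ℕ) (ρ : ℕ → ℕ) : Regs b := fun r => BitVec.ofNat b (ρ r)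

theorem enc_update {b : ℕ} (ρ : ℕ → ℕ) (d v : ℕ) :
    Function.update (enc b ρ) d (BitVec.ofNat b v) = enc b (Function.update ρ d v) := by
  funext r
  by_cases h : r = d <;> simp [enc, Function.update, h]

/-- Started with register contents `ρ`, the program terminates within `T` steps, with register
contents that satisfy `Q`. -/
def Does {b : ℕ} (M : List (BitVec b)) (p : Program) (ρ : ℕ → ℕ) (T : ℕ) (Q : (ℕ → ℕ) → Prop) :
    Prop :=
  ∃ t ρ', Exec M p (enc b ρ) t (enc b ρ') ∧ t ≤ T ∧ Q ρ'

namespace Does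

variable {b : ℕ} {M : List (BitVec b)} {p q : Program} {ρ : ℕ → ℕ} {T T' : ℕ}
  {Q Q' : (ℕ → ℕ) → Prop}

theorem mono (h : Does M p ρ T Q) (hT : T ≤ T') (hQ : ∀ ρ', Q ρ' → Q' ρ') : Does M p ρ T' Q' := by
  obtain ⟨t, ρ', h1, h2, h3⟩ := h
  exact ⟨t, ρ', h1, h2.trans hT, hQ _ h3⟩

theorem seq (h : Does M p ρ T fun ρ' => Does M q ρ' T' Q) : Does M (.seq p q) ρ (T + T') Q := by
  obtain ⟨t, ρ', h1, h2, t', ρ'', h3, h4, h5⟩ := h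
  exact ⟨t + t', ρ'', .seq h1 h3, by omega, h5⟩

theorem nop (h : Q ρ) : Does M .nop ρ 1 Q := ⟨1, ρ, .nop _, le_rfl, h⟩

theorem const {d v : ℕ} (h : Q (Function.update ρ d v)) : Does M (.const d v) ρ 1 Q :=
  ⟨1, _, by rw [← enc_update]; exact .const _ _ _, le_rfl, h⟩

theorem op {o : Op} {d x y v : ℕ} (hv : o.eval (enc b ρ x) (enc b ρ y) = BitVec.ofNat b v)
    (h : Q (Function.update ρ d v)) : Does M (.op o d x y) ρ 1 Q :=
  ⟨1, _, by rw [← enc_update, ← hv]; exact .op _ _ _ _ _, le_rfl, h⟩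

/-- Reduction modulo `2 ^ b` commutes with sums and products, so these rules need no bounds.
Division, remainder, shifts and comparisons do need operands that fit into a word. -/
theorem add {d x y v : ℕ} (hv : ρ x + ρ y = v) (h : Q (Function.update ρ d v)) :
    Does M (.op .add d x y) ρ 1 Q :=
  op (by subst hv; simp [Op.eval, enc, BitVec.ofNat_add]) h

theorem mul {d x y v : ℕ} (hv : ρ x * ρ y = v) (h : Q (Function.update ρ d v)) :
    Does M (.op .mul d x y) ρ 1 Q :=
  op (by subst hv; simp [Op.eval, enc, BitVec.ofNat_mul]) h

theorem sub {d x y v : ℕ} (hle : ρ y ≤ ρ x) (hv : ρ x - ρ y = v) (h : Q (Function.update ρ d v)) :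
    Does M (.op .sub d x y) ρ 1 Q :=
  op (by
    subst hv
    have h1 : ρ x = (ρ x - ρ y) + ρ y := by omega
    simp only [Op.eval, enc]
    conv_lhs => rw [h1, BitVec.ofNat_add]
    simp) h

theorem div {d x y v : ℕ} (hx : ρ x < 2 ^ b) (hy : ρ y < 2 ^ b)
    (hv : ρ x / ρ y = v) (h : Q (Function.update ρ d v)) : Does M (.op .div d x y) ρ 1 Q :=
  op (by
    subst hv
    apply BitVec.eq_of_toNat_eq
    have := (Nat.div_le_self (ρ x) (ρ y)).trans_lt hx
    simp [Op.eval, enc, Nat.mod_eq_of_lt hx, Nat.mod_eq_of_lt hy, Nat.mod_eq_of_lt this]) h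

theorem mod {d x y v : ℕ} (hx : ρ x < 2 ^ b) (hy : ρ y < 2 ^ b)
    (hv : ρ x % ρ y = v) (h : Q (Function.update ρ d v)) : Does M (.op .mod d x y) ρ 1 Q :=
  op (by
    subst hv
    apply BitVec.eq_of_toNat_eq
    have := (Nat.mod_le (ρ x) (ρ y)).trans_lt hx
    simp [Op.eval, enc, Nat.mod_eq_of_lt hx, Nat.mod_eq_of_lt hy, Nat.mod_eq_of_lt this]) h

theorem shr {d x y v : ℕ} (hx : ρ x < 2 ^ b) (hy : ρ y < 2 ^ b)
    (hv : ρ x >>> ρ y = v) (h : Q (Function.update ρ d v)) : Does M (.op .shr d x y) ρ 1 Q :=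
  op (by
    subst hv
    apply BitVec.eq_of_toNat_eq
    have := (Nat.shiftRight_le (ρ x) (ρ y)).trans_lt hx
    simp [Op.eval, enc, Nat.mod_eq_of_lt hx, Nat.mod_eq_of_lt hy, Nat.mod_eq_of_lt this]) h

theorem load {d x a v : ℕ} (ha : ρ x = a) (hx : a < 2 ^ b)
    (hv : M[a]? = some (BitVec.ofNat b v))
    (h : Q (Function.update ρ d v)) : Does M (.load d x) ρ 1 Q :=
  ⟨1, _, by
    rw [← enc_update]
    exact .load _ _ _ _ (by simpa [enc, ha, Nat.mod_eq_of_lt hx] using hv), le_rfl, h⟩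

theorem holds_lt {x y : ℕ} (hx : ρ x < 2 ^ b) (hy : ρ y < 2 ^ b) :
    (Test.lt x y).Holds (enc b ρ) ↔ ρ x < ρ y := by
  simp [Test.Holds, enc, Nat.mod_eq_of_lt hx, Nat.mod_eq_of_lt hy]

theorem holds_eq {x y : ℕ} (hx : ρ x < 2 ^ b) (hy : ρ y < 2 ^ b) :
    (Test.eq x y).Holds (enc b ρ) ↔ ρ x = ρ y := by
  simp [Test.Holds, enc, ← BitVec.toNat_inj, Nat.mod_eq_of_lt hx, Nat.mod_eq_of_lt hy]

theorem cond {c : Test} {P : Prop} (hc : c.Holds (enc b ρ) ↔ P)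
    (h₁ : P → Does M p ρ T Q) (h₂ : ¬ P → Does M q ρ T Q) : Does M (.cond c p q) ρ (T + 1) Q := by
  by_cases h : P
  · obtain ⟨t, ρ', h1, h2, h3⟩ := h₁ h
    exact ⟨t + 1, ρ', .cond_true (hc.mpr h) h1, by omega, h3⟩
  · obtain ⟨t, ρ', h1, h2, h3⟩ := h₂ h
    exact ⟨t + 1, ρ', .cond_false (fun h' => h (hc.mp h')) h1, by omega, h3⟩

theorem loop_exit {c : Test} (hc : ¬ c.Holds (enc b ρ)) (h : Q ρ) : Does M (.loop c p) ρ 1 Q :=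
  ⟨1, ρ, .loop_false hc, le_rfl, h⟩

theorem loop_step {c : Test} (hc : c.Holds (enc b ρ))
    (h : Does M p ρ T fun ρ' => Does M (.loop c p) ρ' T' Q) :
    Does M (.loop c p) ρ (T + T' + 1) Q := by
  obtain ⟨t, ρ', h1, h2, t', ρ'', h3, h4, h5⟩ := h
  exact ⟨t + t' + 1, ρ'', .loop_true hc h1 h3, by omega, h5⟩

end Does

end WordRAM

/-! ### Ranks and tries -/

/-- The points below `X` at which `g` differs from its value at the preceding point. -/
def jumps (g : ℕ → ℕ) (X : ℕ) : Finset ℕ := (Finset.Ico 1 X).filter fun j => g (j - 1) < g j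

theorem card_jumps_le {g : ℕ → ℕ} (hg : Monotone g) {X m : ℕ} (hm : ∀ j, g j ≤ m) :
    (jumps g X).card ≤ m := by
  have hmem : ∀ j ∈ jumps g X, 1 ≤ j ∧ g (j - 1) < g j := fun j hj =>
    ⟨(Finset.mem_Ico.mp (Finset.mem_filter.mp hj).1).1, (Finset.mem_filter.mp hj).2⟩
  have hlt : ∀ i ∈ jumps g X, ∀ j ∈ jumps g X, i < j → g i < g j := fun i _ j hj hij =>
    (hg (by omega : i ≤ j - 1)).trans_lt (hmem j hj).2
  have := Finset.card_le_card_of_injOn (s := jumps g X) (t := Finset.Icc 1 m) g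
    (fun j hj => by
      have := (hmem j hj).2
      have := hm j
      simp only [Finset.coe_Icc, Set.mem_Icc]
      omega)
    (fun i hi j hj hij => by
      rcases lt_trichotomy i j with h | h | h
      · have := hlt i hi j hj h; omega
      · exact h
      · have := hlt j hj i hi h; omega)
  simpa using this

theorem exists_jump {g : ℕ → ℕ} {i j X : ℕ} (hij : i ≤ j) (hj : j < X) (h : g i < g j) :
    ∃ r ∈ jumps g X, i < r ∧ r ≤ j := by
  induction j, hij using Nat.le_induction with
  | base => omega
  | succ j hij ih =>
    by_cases hlt : g i < g j
    · obtain ⟨r, h1, h2, h3⟩ := ih (by omega) hlt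
      exact ⟨r, h1, h2, by omega⟩
    · refine ⟨j + 1, ?_, by omega, le_rfl⟩
      simp only [jumps, Finset.mem_filter, Finset.mem_Ico, Nat.add_sub_cancel]
      omega

/-- The keys of the prefixes of the `L`-bit numbers in `J`, and of the empty prefix. -/
def trieKeys (L : ℕ) (J : Finset ℕ) : Finset ℕ :=
  insert (L * 2 ^ L) ((Finset.range (L + 1) ×ˢ J).image fun z => z.1 * 2 ^ L + z.2 >>> z.1)

theorem card_trieKeys_le (L : ℕ) (J : Finset ℕ) : (trieKeys L J).card ≤ (L + 1) * J.card + 1 := by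
  refine (Finset.card_insert_le _ _).trans (Nat.succ_le_succ (Finset.card_image_le.trans ?_))
  simp

theorem lt_of_mem_trieKeys {L : ℕ} {J : Finset ℕ} (hJ : ∀ r ∈ J, r < 2 ^ L) {k : ℕ}
    (hk : k ∈ trieKeys L J) : k < (L + 1) * 2 ^ L := by
  have h0 : 0 < 2 ^ L := by positivity
  simp only [trieKeys, Finset.mem_insert, Finset.mem_image, Finset.mem_product,
    Finset.mem_range] at hk
  rcases hk with rfl | ⟨⟨s, r⟩, ⟨h1, h2⟩, rfl⟩
  · exact Nat.mul_lt_mul_of_pos_right (Nat.lt_succ_self _) h0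
  · have h3 := (Nat.shiftRight_le r s).trans_lt (hJ r h2)
    have h4 : (s + 1) * 2 ^ L ≤ (L + 1) * 2 ^ L := Nat.mul_le_mul_right _ h1
    simp only [add_mul, one_mul] at h4 ⊢
    omega

/-- The empty prefix is a key even if there are no jumps, so every search over prefixes has a key to
end at. -/
theorem top_mem_trieKeys {L j : ℕ} (J : Finset ℕ) (hj : j < 2 ^ L) :
    L * 2 ^ L + j >>> L ∈ trieKeys L J := by
  rw [Nat.shiftRight_eq_div_pow, Nat.div_eq_of_lt hj]
  exact Finset.mem_insert_self _ _

theorem mem_trieKeys {L s r : ℕ} {J : Finset ℕ} (hs : s ≤ L) (hr : r ∈ J) :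
    s * 2 ^ L + r >>> s ∈ trieKeys L J :=
  Finset.mem_insert_of_mem (Finset.mem_image.mpr
    ⟨(s, r), Finset.mem_product.mpr ⟨Finset.mem_range.mpr (by omega), hr⟩, rfl⟩)

/-- If `g` differed at `j` and `j'`, there would be a jump between them. It lies below their common
node, hence below the child towards `j` or the child towards `j'`, and that child would be in the
trie. -/
theorem eq_of_same_exit {g : ℕ → ℕ} (hg : Monotone g) {L s j j' : ℕ} (hs : s ≤ L) (hle : j ≤ j')
    (hj' : j' < 2 ^ L) (hjj : j >>> s = j' >>> s)
    (h : s = 0 ∨ (s - 1) * 2 ^ L + j >>> (s - 1) ∉ trieKeys L (jumps g (2 ^ L)))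
    (h' : s = 0 ∨ (s - 1) * 2 ^ L + j' >>> (s - 1) ∉ trieKeys L (jumps g (2 ^ L))) :
    g j = g j' := by
  rcases Nat.eq_zero_or_pos s with rfl | hs0
  · simpa using congrArg g hjj
  by_contra hne
  obtain ⟨r, hr, h1, h2⟩ := exists_jump hle hj' (lt_of_le_of_ne (hg hle) hne)
  have hmem := mem_trieKeys (by omega : s - 1 ≤ L) hr
  obtain ⟨s, rfl⟩ : ∃ s', s = s' + 1 := ⟨s - 1, by omega⟩
  simp only [Nat.add_sub_cancel, Nat.add_eq_zero_iff, one_ne_zero, and_false, false_or] at h h' hmem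
  have e1 : j >>> s ≤ r >>> s := by
    simp only [Nat.shiftRight_eq_div_pow]; exact Nat.div_le_div_right h1.le
  have e2 : r >>> s ≤ j' >>> s := by
    simp only [Nat.shiftRight_eq_div_pow]; exact Nat.div_le_div_right h2
  simp only [Nat.shiftRight_succ] at hjj
  -- A node has only two children, so nothing lies strictly between those of `j` and `j'`.
  have : r >>> s = j >>> s ∨ r >>> s = j' >>> s := by omega
  rcases this with e | e
  · exact h (e ▸ hmem)
  · exact h' (e ▸ hmem)

theorem exists_trie_values {g : ℕ → ℕ} (hg : Monotone g) (L : ℕ) :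
    ∃ val : ℕ → ℕ, ∀ s ≤ L, ∀ j < 2 ^ L,
      (s = 0 ∨ (s - 1) * 2 ^ L + j >>> (s - 1) ∉ trieKeys L (jumps g (2 ^ L))) →
      val (s * 2 ^ L + j >>> s) = g j := by
  classical
  -- `E k j` says that `j` leaves the trie at the node with key `k`; `k / 2 ^ L` and `k % 2 ^ L`
  -- decode the number of missing bits and the prefix.
  let E : ℕ → ℕ → Prop := fun k j => j < 2 ^ L ∧ j >>> (k / 2 ^ L) = k % 2 ^ L ∧
    (k / 2 ^ L = 0 ∨
      (k / 2 ^ L - 1) * 2 ^ L + j >>> (k / 2 ^ L - 1) ∉ trieKeys L (jumps g (2 ^ L)))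
  refine ⟨fun k => if h : ∃ j, E k j then g h.choose else 0, fun s hs j hj hx => ?_⟩
  have hlt := (Nat.shiftRight_le j s).trans_lt hj
  have hd : (s * 2 ^ L + j >>> s) / 2 ^ L = s := by
    rw [mul_comm, Nat.mul_add_div (by positivity), Nat.div_eq_of_lt hlt, add_zero]
  have hm : (s * 2 ^ L + j >>> s) % 2 ^ L = j >>> s := by
    rw [mul_comm, Nat.mul_add_mod, Nat.mod_eq_of_lt hlt]
  have hE : ∃ j', E (s * 2 ^ L + j >>> s) j' := ⟨j, hj, by rw [hd, hm], by rwa [hd]⟩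
  simp only [dif_pos hE]
  have hc := hE.choose_spec
  set j' := hE.choose
  obtain ⟨h1, h2, h3⟩ := hc
  rw [hd, hm] at h2
  rw [hd] at h3
  rcases le_total j j' with h | h
  · exact (eq_of_same_exit hg hs h h1 h2.symm hx h3).symm
  · exact eq_of_same_exit hg hs h hj h2 h3 hx

/-- The bound on `m` matters, as `Nat.nth` is `0` beyond the last element of a finite set. -/
theorem nth_lt_iff_lt_count {T : Finset ℕ} {m j : ℕ} (hm : m < T.card) :
    Nat.nth (· ∈ T) m < j ↔ m < Nat.count (· ∈ T) j := by
  constructor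
  · intro h
    have hf : ∀ hf : (Set.ofPred (· ∈ T)).Finite, m < hf.toFinset.card := by
      intro hf
      have : hf.toFinset = T := by
        ext x
        rw [Set.Finite.mem_toFinset]
        rfl
      rwa [this]
    have h1 : Nat.count (· ∈ T) (Nat.nth (· ∈ T) m) = m := Nat.count_nth hf
    have h2 := Nat.nth_mem m hf
    have h3 : Nat.count (· ∈ T) (Nat.nth (· ∈ T) m + 1) = m + 1 := by
      rw [Nat.count_succ, h1, if_pos h2]
    have := Nat.count_monotone (· ∈ T) (Nat.succ_le_of_lt h)
    simp only [Nat.succ_eq_add_one] at this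
    omega
  · exact Nat.nth_lt_of_lt_count

theorem count_le_card (T : Finset ℕ) (j : ℕ) : Nat.count (· ∈ T) j ≤ T.card := by
  rw [Nat.count_eq_card_filter_range]
  exact Finset.card_le_card fun x hx => (Finset.mem_filter.mp hx).2

namespace WordRAM

/-! ### The query program -/

/-- Put field `f` of the record whose index is in register `x` into register `d`. -/
def fetch (f d x : ℕ) : Program :=
  .seq (.const 20 8) (.seq (.op .mul 20 x 20) (.seq (.const 21 f)
    (.seq (.op .add 20 20 21) (.load d 20))))

/-- Look up the key in register `14`: register `15` tells whether it was found, and register `16`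
holds its value. -/
def lookup : Program :=
  .seq (.op .mul 17 4 14) (.seq (.op .mod 17 17 2) (.seq (.op .mod 17 17 3)
    (.seq (fetch 1 18 17) (.seq (.op .mul 18 18 14) (.seq (.op .mod 18 18 2)
    (.seq (fetch 3 19 17) (.seq (.op .mod 18 18 19) (.seq (fetch 2 19 17)
    (.seq (.op .add 18 18 19) (.seq (fetch 4 15 18) (.seq (fetch 5 16 18)
    (.cond (.eq 15 14) (.const 15 1) (.const 15 0)))))))))))))

/-- Find the least number from register `11` on that passes the test `p`, or else the number in
register `12`. -/
def bsearch (p : Program) : Program :=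
  .loop (.lt 11 12) (.seq (.op .add 13 11 12) (.seq (.op .div 13 13 10) (.seq p
    (.cond (.eq 15 9) (.op .add 12 13 1) (.op .add 11 13 9)))))

/-- Look up the prefix of the query point in register `8` that misses the number of bits in
register `x`. -/
def lookupPrefix (x : ℕ) : Program :=
  .seq (.op .mul 14 x 5) (.seq (.op .shr 17 8 x) (.seq (.op .add 14 14 17) lookup))

/-- Test whether the element whose index is in register `13` is at least the query point. -/
def testElement : Program :=
  .seq (fetch 6 15 13) (.cond (.lt 15 8) (.const 15 0) (.const 15 1))

/-- Compute the rank of the query point `i` or `i + 1`, for the number `i` in register `0`, into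
register `16`. -/
def searchRank (strict : Bool) : Program :=
  .seq (.op .add 8 0 (if strict then 1 else 9)) (.seq (.op .add 11 1 1) (.seq (.op .add 12 6 1)
    (.seq (bsearch (lookupPrefix 13)) (.seq (lookupPrefix 11) (.seq (.op .add 11 16 1)
    (.seq (.op .add 12 11 6) (.seq (.cond (.lt 7 12) (.op .add 12 7 1) .nop)
    (.seq (bsearch testElement) (.op .add 16 11 1)))))))))

/-- Load the parameters of the data structure. -/
def loadParameters : Program :=
  .seq (.const 9 1) (.seq (.const 10 2) (.seq (.const 11 0) (.seq (fetch 0 2 11)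
    (.seq (.const 11 1) (.seq (fetch 0 3 11) (.seq (.const 11 2) (.seq (fetch 0 4 11)
    (.seq (.const 11 3) (.seq (fetch 0 5 11) (.seq (.const 11 4) (.seq (fetch 0 6 11)
    (.seq (.const 11 5) (fetch 0 7 11)))))))))))))

/-- Look up the rank of a heavy query point. -/
def lookupHeavy : Program :=
  .seq (.op .add 14 6 9) (.seq (.op .mul 14 14 5) (.seq (.op .add 14 14 0) lookup))

/-- Report the answer, given the rank in register `16`. -/
def report : Program :=
  .cond (.eq 16 1) (.const 0 0) (.seq (.op .sub 16 16 9) (.seq (fetch 6 1 16) (.const 0 1)))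

/-- The query program. -/
def query (strict : Bool) : Program :=
  .seq loadParameters (.seq lookupHeavy (.seq (.cond (.eq 15 9) .nop (searchRank strict)) report))

/-- `M` consists of `R` records with eight fields each, and field `f` of record `r` holds
`mem f r`. -/
structure Layout {b : ℕ} (M : List (BitVec b)) (mem : ℕ → ℕ → ℕ) (R : ℕ) : Prop where
  get : ∀ f < 8, ∀ r < R, M[r * 8 + f]? = some (BitVec.ofNat b (mem f r))
  bound : R * 8 ≤ 2 ^ b

/-- The fields `1` to `5` are a hash table for the keys `K` with values `val`. -/
structure IsDict (b : ℕ) (mem : ℕ → ℕ → ℕ) (R p N a : ℕ) (K : Finset ℕ) (val : ℕ → ℕ) :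
    Prop where
  a_lt : a < p
  N_lt : N < 2 ^ b
  bound : p * p < 2 ^ b
  bucket_lt : ∀ x, a * x % p % N < R
  mult_lt : ∀ h, mem 1 h < p
  md_lt : ∀ x, mem 3 (a * x % p % N) < 2 ^ b
  slot_lt : ∀ x, hashSlot p N a (mem 1) (mem 2) (mem 3) x < R
  key_le : ∀ c, mem 4 c ≤ p
  found : ∀ x < p, mem 4 (hashSlot p N a (mem 1) (mem 2) (mem 3) x) = x ↔ x ∈ K
  value : ∀ x ∈ K, mem 5 (hashSlot p N a (mem 1) (mem 2) (mem 3) x) = val x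

/-! ### Correctness and running time of the query program -/

section

variable {b : ℕ} {M : List (BitVec b)} {mem : ℕ → ℕ → ℕ} {R : ℕ}

theorem Does.fetch (hM : Layout M mem R) {ρ : ℕ → ℕ} {f d x r : ℕ} {Q : (ℕ → ℕ) → Prop}
    (hf : f < 8) (hr : r < R) (hx' : x ≠ 20) (hx : ρ x = r)
    (h : Q (Function.update (Function.update (Function.update ρ 20 (r * 8 + f)) 21 f) d
      (mem f r))) : Does M (fetch f d x) ρ 5 Q := by
  have hb := hM.bound
  refine .seq (T := 1) (T' := 4) (.const (.seq (T := 1) (T' := 3) (.mul (v := r * 8) ?_ (.seq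
    (T := 1) (T' := 2) (.const (.seq (T := 1) (T' := 1) (.add (v := r * 8 + f) ?_
      (.load (v := mem f r) (a := r * 8 + f) ?_ ?_ ?_ ?_))))))))
  · simp [hx', hx]
  · simp
  · simp
  · omega
  · exact hM.get f hf _ hr
  · convert h using 1
    funext i
    by_cases h1 : i = d
    · simp [h1]
    · by_cases h2 : i = 20 <;> by_cases h3 : i = 21 <;> simp_all

/-- The two register contents agree on the registers below `11`. -/
def Frame (ρ₀ ρ : ℕ → ℕ) : Prop := ∀ r < 11, ρ r = ρ₀ r

theorem Frame.update {ρ₀ ρ : ℕ → ℕ} (h : Frame ρ₀ ρ) {d v : ℕ} (hd : 11 ≤ d) :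
    Frame ρ₀ (Function.update ρ d v) := fun r hr => by
  rw [Function.update_of_ne (by omega)]
  exact h r hr

theorem Frame.trans {ρ₀ ρ₁ ρ₂ : ℕ → ℕ} (h : Frame ρ₀ ρ₁) (h' : Frame ρ₁ ρ₂) : Frame ρ₀ ρ₂ :=
  fun r hr => (h' r hr).trans (h r hr)

/-- Keys and multipliers are below `p` and `p * p < 2 ^ b`, so no product wraps around. -/
theorem does_lookup (hM : Layout M mem R) {p N a : ℕ} {K : Finset ℕ} {val : ℕ → ℕ}
    (hD : IsDict b mem R p N a K val) {ρ : ℕ → ℕ} (h2 : ρ 2 = p) (h3 : ρ 3 = N) (h4 : ρ 4 = a)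
    (hk : ρ 14 < p) :
    Does M lookup ρ 34 fun ρ' => (∀ r < 14, ρ' r = ρ r) ∧ (ρ' 15 = if ρ 14 ∈ K then 1 else 0) ∧
      (ρ 14 ∈ K → ρ' 16 = val (ρ 14)) := by
  have hpb : p < 2 ^ b := (Nat.le_mul_self p).trans_lt hD.bound
  have hax : a * ρ 14 < 2 ^ b := (Nat.mul_le_mul hD.a_lt.le hk.le).trans_lt hD.bound
  have hbu := hD.bucket_lt (ρ 14)
  have hmx : mem 1 (a * ρ 14 % p % N) * ρ 14 < 2 ^ b :=
    (Nat.mul_le_mul (hD.mult_lt _).le hk.le).trans_lt hD.bound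
  have hsl := hD.slot_lt (ρ 14)
  have hap : a * ρ 14 % p < 2 ^ b := (Nat.mod_le _ _).trans_lt hax
  have hmp : mem 1 (a * ρ 14 % p % N) * ρ 14 % p < 2 ^ b := (Nat.mod_le _ _).trans_lt hmx
  have hmd := hD.md_lt (ρ 14)
  have hN := hD.N_lt
  have hkey : mem 4 (hashSlot p N a (mem 1) (mem 2) (mem 3) (ρ 14)) < 2 ^ b :=
    (hD.key_le _).trans_lt hpb
  have hfound := hD.found _ hk
  have hval := hD.value (ρ 14)
  unfold hashSlot at hsl hkey hfound hval
  unfold lookup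
  set h := a * ρ 14 % p % N
  set c := mem 1 h * ρ 14 % p % mem 3 h
  refine .seq (T := 1) (T' := 33) (.mul (v := a * ρ 14) (by simp [h4]) ?_)
  refine .seq (T := 1) (T' := 32) (.mod (v := a * ρ 14 % p) (by simpa) (by simpa [h2])
    (by simp [h2]) ?_)
  refine .seq (T := 1) (T' := 31) (.mod (v := h) (by simpa) (by simpa [h3]) (by simp [h, h3]) ?_)
  refine .seq (T := 5) (T' := 26) (.fetch hM (r := h) (by simp) hbu (by simp) (by simp) ?_)
  refine .seq (T := 1) (T' := 25) (.mul (v := mem 1 h * ρ 14) (by simp) ?_)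
  refine .seq (T := 1) (T' := 24) (.mod (v := mem 1 h * ρ 14 % p) (by simpa) (by simpa [h2])
    (by simp [h2]) ?_)
  refine .seq (T := 5) (T' := 19) (.fetch hM (r := h) (by simp) hbu (by simp) (by simp) ?_)
  refine .seq (T := 1) (T' := 18) (.mod (v := c) (by simpa) (by simpa) (by simp [c]) ?_)
  refine .seq (T := 5) (T' := 13) (.fetch hM (r := h) (by simp) hbu (by simp) (by simp) ?_)
  refine .seq (T := 1) (T' := 12) (.add (v := c + mem 2 h) (by simp) ?_)
  refine .seq (T := 5) (T' := 7) (.fetch hM (r := c + mem 2 h) (by simp) hsl (by simp) (by simp) ?_)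
  refine .seq (T := 5) (T' := 2) (.fetch hM (r := c + mem 2 h) (by simp) hsl (by simp) (by simp) ?_)
  refine Does.cond (P := ρ 14 ∈ K) ((Does.holds_eq ?_ ?_).trans ?_)
    (fun hin => .const (And.intro (fun r hr => ?_) (And.intro ?_ fun h' => ?_)))
    (fun hin => .const (And.intro (fun r hr => ?_) (And.intro ?_ fun h' => ?_)))
  · simpa using hkey
  · simpa using hk.trans hpb
  · simpa using hfound
  · simp [show r ≠ 15 by omega, show r ≠ 16 by omega, show r ≠ 17 by omega,
      show r ≠ 18 by omega, show r ≠ 19 by omega, show r ≠ 20 by omega, show r ≠ 21 by omega]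
  · simp [hin]
  · simpa using hval (by simpa using h')
  · simp [show r ≠ 15 by omega, show r ≠ 16 by omega, show r ≠ 17 by omega,
      show r ≠ 18 by omega, show r ≠ 19 by omega, show r ≠ 20 by omega, show r ≠ 21 by omega]
  · simp [hin]
  · exact absurd h' hin

/-- `P` need not be monotone: the search keeps `P` at its upper end and `¬ P` just below its lower
end, unless these ends are the original ones, and such a local boundary is all that is used. The
bound on `2 * H` keeps the sum in the midpoint from overflowing. -/
theorem does_bsearch {p : Program} {C H : ℕ} {ρ₀ : ℕ → ℕ} (h1 : ρ₀ 1 = 0) (h9 : ρ₀ 9 = 1)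
    (h10 : ρ₀ 10 = 2) (hH : 2 * H < 2 ^ b) (P : ℕ → Prop) [DecidablePred P]
    (hp : ∀ ρ, Frame ρ₀ ρ → ρ 13 < H →
      Does M p ρ C fun ρ' => (∀ r < 14, ρ' r = ρ r) ∧ ρ' 15 = if P (ρ 13) then 1 else 0)
    (k : ℕ) (ρ : ℕ → ℕ) (hρ : Frame ρ₀ ρ) (hle : ρ 11 ≤ ρ 12) (hρH : ρ 12 ≤ H)
    (hk : ρ 12 - ρ 11 < 2 ^ k) :
    Does M (bsearch p) ρ (k * (C + 5) + 1) fun ρ' => Frame ρ₀ ρ' ∧ ρ 11 ≤ ρ' 11 ∧ ρ' 11 ≤ ρ 12 ∧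
      (ρ' 11 = ρ 12 ∨ P (ρ' 11)) ∧ (ρ' 11 = ρ 11 ∨ ¬ P (ρ' 11 - 1)) := by
  have h9' : ∀ {ρ}, Frame ρ₀ ρ → ρ 9 = 1 := fun h => (h 9 (by omega)).trans h9
  have h10' : ∀ {ρ}, Frame ρ₀ ρ → ρ 10 = 2 := fun h => (h 10 (by omega)).trans h10
  have h1' : ∀ {ρ}, Frame ρ₀ ρ → ρ 1 = 0 := fun h => (h 1 (by omega)).trans h1
  induction k generalizing ρ with
  | zero =>
    have hlt : (Test.lt 11 12).Holds (enc b ρ) ↔ ρ 11 < ρ 12 :=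
      Does.holds_lt (by omega) (by omega)
    rw [pow_zero] at hk
    refine (Does.loop_exit (fun h => absurd (hlt.mp h) (by omega)) ?_).mono
      (Nat.le_add_left _ _) fun _ h => h
    exact ⟨hρ, le_rfl, hle, .inl (by omega), .inl rfl⟩
  | succ k ih =>
    have hlt : (Test.lt 11 12).Holds (enc b ρ) ↔ ρ 11 < ρ 12 :=
      Does.holds_lt (by omega) (by omega)
    by_cases hc : ρ 11 < ρ 12
    swap
    · refine (Does.loop_exit (fun h => hc (hlt.mp h)) ?_).mono (Nat.le_add_left _ _) fun _ h => h
      exact ⟨hρ, le_rfl, hle, .inl (by omega), .inl rfl⟩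
    -- One round costs `C` for the test program and `5` for the loop test, the midpoint, the branch
    -- and the update.
    rw [show (k + 1) * (C + 5) + 1 = (1 + (1 + (C + 2))) + (k * (C + 5) + 1) + 1 by ring]
    set m := (ρ 11 + ρ 12) / 2 with hm
    refine .loop_step (hlt.mpr hc) (.seq (.add rfl (.seq (.div (v := m) ?_ ?_ ?_ (.seq ?_)))))
    · simp; omega
    · simp [h10' hρ]; omega
    · simp [h10' hρ, hm]
    rw [Function.update_idem]
    refine (hp _ (hρ.update (by omega)) (by simp; omega)).mono le_rfl fun ρ' h => ?_
    obtain ⟨hfr, h15⟩ := h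
    have hρ' : Frame ρ₀ ρ' := (hρ.update (by omega)).trans fun r hr => hfr r (by omega)
    have e11 : ρ' 11 = ρ 11 := by rw [hfr 11 (by omega)]; simp
    have e12 : ρ' 12 = ρ 12 := by rw [hfr 12 (by omega)]; simp
    have e13 : ρ' 13 = m := by rw [hfr 13 (by omega)]; simp
    simp only [Function.update_self] at h15
    have hb2 : 2 ≤ 2 ^ b := by omega
    rw [pow_succ] at hk
    refine Does.cond (P := P m) ((Does.holds_eq ?_ ?_).trans ?_) (fun hPm => .add (v := m) ?_ ?_)
      fun hPm => .add (v := m + 1) ?_ ?_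
    · rw [h15]; split_ifs <;> omega
    · rw [h9' hρ']; omega
    · rw [h15, h9' hρ']; split_ifs with h <;> simp [h]
    · rw [e13, h1' hρ', add_zero]
    · have hrest : ∀ ρ'' : ℕ → ℕ, ρ'' 11 = ρ 11 → ρ'' 12 = m → Frame ρ₀ ρ'' →
          Does M (bsearch p) ρ'' (k * (C + 5) + 1) fun ρ' => Frame ρ₀ ρ' ∧ ρ 11 ≤ ρ' 11 ∧
            ρ' 11 ≤ ρ 12 ∧ (ρ' 11 = ρ 12 ∨ P (ρ' 11)) ∧ (ρ' 11 = ρ 11 ∨ ¬ P (ρ' 11 - 1)) := by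
        intro ρ'' f11 f12 hf
        refine (ih ρ'' hf (by omega) (by omega) (by omega)).mono le_rfl ?_
        rintro σ ⟨g1, g2, g3, g4, g5⟩
        refine ⟨g1, by omega, by omega, ?_, by rwa [f11] at g5⟩
        rcases g4 with g4 | g4
        · exact .inr (by rw [g4, f12]; exact hPm)
        · exact .inr g4
      exact hrest _ (by simpa using e11) (by simp) (hρ'.update (by omega))
    · rw [e13, h9' hρ']
    · have hrest : ∀ ρ'' : ℕ → ℕ, ρ'' 11 = m + 1 → ρ'' 12 = ρ 12 → Frame ρ₀ ρ'' →
          Does M (bsearch p) ρ'' (k * (C + 5) + 1) fun ρ' => Frame ρ₀ ρ' ∧ ρ 11 ≤ ρ' 11 ∧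
            ρ' 11 ≤ ρ 12 ∧ (ρ' 11 = ρ 12 ∨ P (ρ' 11)) ∧ (ρ' 11 = ρ 11 ∨ ¬ P (ρ' 11 - 1)) := by
        intro ρ'' f11 f12 hf
        refine (ih ρ'' hf (by omega) (by omega) (by omega)).mono le_rfl ?_
        rintro σ ⟨g1, g2, g3, g4, g5⟩
        refine ⟨g1, by omega, by omega, by rwa [f12] at g4, ?_⟩
        rcases g5 with g5 | g5
        · exact .inr (by rw [g5, f11]; exact hPm)
        · exact .inr g5
      exact hrest _ (by simp) (by simpa using e12) (hρ'.update (by omega))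

theorem does_lookupPrefix (hM : Layout M mem R) {p N a L j s : ℕ} {K : Finset ℕ} {val : ℕ → ℕ}
    (hD : IsDict b mem R p N a K val) (hp : (L + 1) * 2 ^ L ≤ p) {ρ : ℕ → ℕ} (h2 : ρ 2 = p)
    (h3 : ρ 3 = N) (h4 : ρ 4 = a) (h5 : ρ 5 = 2 ^ L) (h8 : ρ 8 = j) (hj : j < 2 ^ L) {x : ℕ}
    (hx : x < 14) (hs : ρ x = s) (hsL : s ≤ L) :
    Does M (lookupPrefix x) ρ 37 fun ρ' => (∀ r < 14, ρ' r = ρ r) ∧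
      (ρ' 15 = if s * 2 ^ L + j >>> s ∈ K then 1 else 0) ∧
      (s * 2 ^ L + j >>> s ∈ K → ρ' 16 = val (s * 2 ^ L + j >>> s)) := by
  have hpb : p < 2 ^ b := (Nat.le_mul_self p).trans_lt hD.bound
  have hL : L < 2 ^ L := Nat.lt_two_pow_self
  have hLp : 2 ^ L ≤ p := (Nat.le_mul_of_pos_left _ (Nat.succ_pos L)).trans hp
  have hkey : s * 2 ^ L + j >>> s < p := by
    have h1 := (Nat.shiftRight_le j s).trans_lt hj
    have h2 : s * 2 ^ L ≤ L * 2 ^ L := Nat.mul_le_mul_right _ hsL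
    rw [add_mul, one_mul] at hp
    omega
  refine .seq (T := 1) (T' := 36) (.mul (v := s * 2 ^ L) (by rw [hs, h5]) ?_)
  refine .seq (T := 1) (T' := 35) (.shr (v := j >>> s) ?_ ?_ ?_ ?_)
  · simp [h8]; omega
  · rw [Function.update_of_ne (by omega), hs]; omega
  · rw [Function.update_of_ne (by omega), Function.update_of_ne (by omega), hs, h8]
  refine .seq (T := 1) (T' := 34) (.add (v := s * 2 ^ L + j >>> s) (by simp) ?_)
  refine (does_lookup hM hD (by simpa) (by simpa) (by simpa) (by simpa)).mono le_rfl ?_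
  rintro ρ' ⟨e1, e2, e3⟩
  refine ⟨fun r hr => ?_, by simpa using e2, by simpa using e3⟩
  rw [e1 r hr]
  simp [show r ≠ 14 by omega, show r ≠ 17 by omega]

theorem does_testElement (hM : Layout M mem R) {j m : ℕ} {ρ : ℕ → ℕ} (h8 : ρ 8 = j)
    (hj : j < 2 ^ b) (h13 : ρ 13 = m) (hm : m < R) (hS : mem 6 m < 2 ^ b) :
    Does M testElement ρ 7 fun ρ' => (∀ r < 14, ρ' r = ρ r) ∧
      ρ' 15 = if j ≤ mem 6 m then 1 else 0 := by
  refine .seq (T := 5) (T' := 2) (.fetch hM (r := m) (by simp) hm (by simp) h13 ?_)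
  have hfr : ∀ v, ∀ r < 14, Function.update (Function.update (Function.update (Function.update ρ 20
      (m * 8 + 6)) 21 6) 15 (mem 6 m)) 15 v r = ρ r := fun v r hr => by
    simp [show r ≠ 15 by omega, show r ≠ 20 by omega, show r ≠ 21 by omega]
  refine Does.cond (P := mem 6 m < j) ((Does.holds_lt ?_ ?_).trans ?_)
    (fun h => .const (And.intro (hfr _) ?_)) (fun h => .const (And.intro (hfr _) ?_))
  · simpa
  · simpa [h8]
  · simp [h8]
  · simp [h]
  · simp [not_lt.mp h]

/-- Both searches run over an interval of length at most `L < 2 ^ k`: the numbers of missing bits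
from `0` to `L`, then the indices from `l` to `min (l + L) n`. -/
theorem does_searchRank (hM : Layout M mem R) {p N a L n i l rk k : ℕ} {K : Finset ℕ}
    {val : ℕ → ℕ} (hD : IsDict b mem R p N a K val) (hp : (L + 1) * 2 ^ L ≤ p) (hk : L < 2 ^ k)
    (hnR : n ≤ R) (hnb : 2 * n < 2 ^ b) (strict : Bool) {j : ℕ}
    (hij : i + (if strict then 0 else 1) = j) (hj : j < 2 ^ L)
    (htop : L * 2 ^ L + j >>> L ∈ K)
    (hval : ∀ s ≤ L, (s = 0 ∨ (s - 1) * 2 ^ L + j >>> (s - 1) ∉ K) →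
      val (s * 2 ^ L + j >>> s) = l)
    (hl : l ≤ rk) (hl' : rk < l + L) (hrk : rk ≤ n) (hSb : ∀ m < n, mem 6 m < 2 ^ b)
    (hS : ∀ m < n, mem 6 m < j ↔ m < rk) {ρ : ℕ → ℕ} (h0 : ρ 0 = i) (h1 : ρ 1 = 0) (h2 : ρ 2 = p)
    (h3 : ρ 3 = N) (h4 : ρ 4 = a) (h5 : ρ 5 = 2 ^ L) (h6 : ρ 6 = L) (h7 : ρ 7 = n) (h9 : ρ 9 = 1)
    (h10 : ρ 10 = 2) :
    Does M (searchRank strict) ρ (54 * k + 47) fun ρ' => ρ' 1 = 0 ∧ ρ' 9 = 1 ∧ ρ' 16 = rk := by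
  have hL : L < 2 ^ L := Nat.lt_two_pow_self
  have hLp : (L + 1) * 2 ^ L ≤ p := hp
  have hpb : p < 2 ^ b := (Nat.le_mul_self p).trans_lt hD.bound
  have hL1 : 1 ≤ L := by omega
  have hLb : 2 * 2 ^ L < 2 ^ b :=
    ((Nat.mul_le_mul_right _ (by omega : 2 ≤ L + 1)).trans hp).trans_lt hpb
  refine Does.mono (T := 1 + (1 + (1 + ((k * (37 + 5) + 1) + (37 + (1 + (1 + (2 +
    ((k * (7 + 5) + 1) + 1))))))))) ?_ (by omega) fun _ h => h
  refine .seq (.add (v := j) ?_ ?_)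
  · rw [← hij, h0]; cases strict <;> simp [h1, h9]
  set ρ₀ := Function.update ρ 8 j with hρ₀
  refine .seq (.add (v := 0) (by simp [hρ₀, h1]) ?_)
  refine .seq (.add (v := L) (by simp [hρ₀, h1, h6]) ?_)
  have hF : Frame ρ₀ ρ₀ := fun _ _ => rfl
  have g : ∀ {σ : ℕ → ℕ}, Frame ρ₀ σ → σ 1 = 0 ∧ σ 2 = p ∧ σ 3 = N ∧ σ 4 = a ∧ σ 5 = 2 ^ L ∧
      σ 6 = L ∧ σ 7 = n ∧ σ 8 = j ∧ σ 9 = 1 := by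
    intro σ hσ
    refine ⟨?_, ?_, ?_, ?_, ?_, ?_, ?_, ?_, ?_⟩ <;> rw [hσ _ (by omega)] <;>
      simp [*]
  have b1 : ρ₀ 1 = 0 := (g hF).1
  have b9 : ρ₀ 9 = 1 := by simpa [hρ₀]
  have b10 : ρ₀ 10 = 2 := by simpa [hρ₀]
  refine .seq (Does.mono (does_bsearch b1 b9 b10 (H := L) (by omega)
    (fun s => s * 2 ^ L + j >>> s ∈ K) (fun σ hσ hlt => ?_) k _
    ((hF.update (by omega)).update (by omega)) (by simp) (by simp) (by simpa)) le_rfl ?_)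
  · obtain ⟨-, c2, c3, c4, c5, -, -, c8, -⟩ := g hσ
    exact (does_lookupPrefix hM hD hp c2 c3 c4 c5 c8 hj (by omega) rfl (by omega)).mono le_rfl
      fun _ h => ⟨h.1, h.2.1⟩
  simp only [Function.update_self, ne_eq, Nat.reduceEqDiff, not_false_eq_true,
    Function.update_of_ne]
  rintro σ ⟨hσ, -, t2, t3, t4⟩
  obtain ⟨c1, c2, c3, c4, c5, c6, c7, c8, c9⟩ := g hσ
  refine .seq ((does_lookupPrefix hM hD hp c2 c3 c4 c5 c8 hj (by omega) rfl t2).mono le_rfl ?_)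
  rintro σ₁ ⟨hσ₁, -, hv⟩
  have hin : σ 11 * 2 ^ L + j >>> σ 11 ∈ K := by
    rcases t3 with t3 | t3
    · rw [t3]; exact htop
    · exact t3
  have h16 : σ₁ 16 = l := by rw [hv hin]; exact hval _ t2 t4
  have hσ₁F : Frame ρ₀ σ₁ := hσ.trans fun r hr => hσ₁ r (by omega)
  obtain ⟨c1, c2, c3, c4, c5, c6, c7, c8, c9⟩ := g hσ₁F
  refine .seq (.add (v := l) (by rw [h16, c1, add_zero]) (.seq (.add (v := l + L)
    (by simp [c6]) (.seq ?_))))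
  -- Both branches of the clipping at `n` end in this situation; the clipping keeps the search
  -- inside the list of elements.
  have hrest : ∀ σ₂ : ℕ → ℕ, Frame ρ₀ σ₂ → σ₂ 11 = l → σ₂ 12 = min (l + L) n →
      Does M (.seq (bsearch testElement) (.op .add 16 11 1)) σ₂ ((k * (7 + 5) + 1) + 1)
        fun ρ' => ρ' 1 = 0 ∧ ρ' 9 = 1 ∧ ρ' 16 = rk := by
    intro σ₂ hσ₂ e11 e12
    refine .seq (Does.mono (does_bsearch b1 b9 b10 (H := n) hnb
      (fun m => j ≤ mem 6 m) (fun τ hτ hlt => ?_) k σ₂ hσ₂ (by omega) (by omega) (by omega))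
      le_rfl ?_)
    · exact does_testElement hM (g hτ).2.2.2.2.2.2.2.1 (by omega) rfl (by omega) (hSb _ hlt)
    rintro τ ⟨hτ, u1, u2, u3, u4⟩
    refine .add (v := rk) ?_ ⟨?_, ?_, ?_⟩
    · rw [(g hτ).1, add_zero]
      apply le_antisymm
      · rcases u4 with u4 | u4
        · omega
        · by_cases h0 : τ 11 = 0
          · omega
          · rw [not_le, hS _ (by omega)] at u4
            omega
      · rcases u3 with u3 | u3
        · omega
        · by_contra hlt
          rw [not_le] at hlt
          exact absurd ((hS _ (by omega)).mpr hlt) (by omega)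
    · simpa using (g hτ).1
    · simpa using (g hτ).2.2.2.2.2.2.2.2
    · simp
  refine Does.cond (P := n < l + L) ((Does.holds_lt ?_ ?_).trans ?_) (fun h => .add (v := n) ?_ ?_)
    fun h => .nop ?_
  · simp [c7]; omega
  · simp; omega
  · simp [c7]
  · simp [c7, c1]
  · exact hrest _ (((hσ₁F.update (by omega)).update (by omega)).update (by omega)) (by simp)
      (by simp; omega)
  · exact hrest _ ((hσ₁F.update (by omega)).update (by omega)) (by simp) (by simp; omega)

theorem does_loadParameters (hM : Layout M mem R) (hR : 6 ≤ R) (ρ : ℕ → ℕ) :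
    Does M loadParameters ρ 38 fun ρ' => ρ' 0 = ρ 0 ∧ ρ' 1 = ρ 1 ∧ ρ' 2 = mem 0 0 ∧
      ρ' 3 = mem 0 1 ∧ ρ' 4 = mem 0 2 ∧ ρ' 5 = mem 0 3 ∧ ρ' 6 = mem 0 4 ∧ ρ' 7 = mem 0 5 ∧
      ρ' 9 = 1 ∧ ρ' 10 = 2 := by
  refine .seq (T := 1) (T' := 37) (.const ?_)
  refine .seq (T := 1) (T' := 36) (.const ?_)
  refine .seq (T := 1) (T' := 35) (.const ?_)
  refine .seq (T := 5) (T' := 30) (.fetch hM (by simp) (by omega) (by simp)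
    (Function.update_self _ _ _) ?_)
  refine .seq (T := 1) (T' := 29) (.const ?_)
  refine .seq (T := 5) (T' := 24) (.fetch hM (by simp) (by omega) (by simp)
    (Function.update_self _ _ _) ?_)
  refine .seq (T := 1) (T' := 23) (.const ?_)
  refine .seq (T := 5) (T' := 18) (.fetch hM (by simp) (by omega) (by simp)
    (Function.update_self _ _ _) ?_)
  refine .seq (T := 1) (T' := 17) (.const ?_)
  refine .seq (T := 5) (T' := 12) (.fetch hM (by simp) (by omega) (by simp)
    (Function.update_self _ _ _) ?_)
  refine .seq (T := 1) (T' := 11) (.const ?_)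
  refine .seq (T := 5) (T' := 6) (.fetch hM (by simp) (by omega) (by simp)
    (Function.update_self _ _ _) ?_)
  refine .seq (T := 1) (T' := 5) (.const ?_)
  refine .fetch hM (by simp) (by omega) (by simp) (Function.update_self _ _ _) ?_
  simp

/-- Register `0` is `0` if `rk = 0`, and otherwise register `0` is `1` and register `1` holds
`elem (rk - 1)`. -/
def Answers (elem : ℕ → ℕ) (rk : ℕ) (ρ : ℕ → ℕ) : Prop :=
  (rk = 0 → ρ 0 = 0) ∧ (0 < rk → ρ 0 = 1 ∧ ρ 1 = elem (rk - 1))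

theorem does_report (hM : Layout M mem R) {rk : ℕ} (hrk : rk ≤ R) (hRb : R < 2 ^ b) {ρ : ℕ → ℕ}
    (h1 : ρ 1 = 0) (h9 : ρ 9 = 1) (h16 : ρ 16 = rk) : Does M report ρ 8 (Answers (mem 6) rk) := by
  refine Does.cond (P := rk = 0) ((Does.holds_eq ?_ ?_).trans ?_)
    (fun h => .mono (T := 1) (.const ?_) (by omega) fun _ h => h) fun h => ?_
  · omega
  · omega
  · rw [h16, h1]
  · exact ⟨fun _ => by simp, fun h' => by omega⟩
  · refine .seq (T := 1) (T' := 6) (.sub (v := rk - 1) ?_ ?_ ?_)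
    · omega
    · rw [h16, h9]
    · refine .seq (T := 5) (T' := 1) (.fetch hM (r := rk - 1) (by simp) (by omega) (by simp)
        (by simp) (.const ?_))
      exact ⟨fun h' => absurd h' h, fun _ => by simp⟩

theorem does_query (hM : Layout M mem R) (hR : 6 ≤ R) (hRb : R < 2 ^ b) {p N a L n i l rk k : ℕ}
    {K : Finset ℕ} {val : ℕ → ℕ} (hD : IsDict b mem R p N a K val) (e0 : mem 0 0 = p)
    (e1 : mem 0 1 = N) (e2 : mem 0 2 = a) (e3 : mem 0 3 = 2 ^ L) (e4 : mem 0 4 = L)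
    (e5 : mem 0 5 = n) (hp : (L + 2) * 2 ^ L ≤ p) (hk : L < 2 ^ k)
    (hnR : n ≤ R) (hnb : 2 * n < 2 ^ b) (strict : Bool) {j : ℕ}
    (hij : i + (if strict then 0 else 1) = j) (hj : j < 2 ^ L)
    (hheavy : (L + 1) * 2 ^ L + i ∈ K → val ((L + 1) * 2 ^ L + i) = rk)
    (htop : L * 2 ^ L + j >>> L ∈ K)
    (hval : ∀ s ≤ L, (s = 0 ∨ (s - 1) * 2 ^ L + j >>> (s - 1) ∉ K) →
      val (s * 2 ^ L + j >>> s) = l)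
    (hl : l ≤ rk) (hl' : rk < l + L) (hrk : rk ≤ n) (hSb : ∀ m < n, mem 6 m < 2 ^ b)
    (hS : ∀ m < n, mem 6 m < j ↔ m < rk) :
    Does M (query strict) (fun r => if r = 0 then i else 0)
      (if (L + 1) * 2 ^ L + i ∈ K then 85 else 54 * k + 131) (Answers (mem 6) rk) := by
  have hkey : (L + 1) * 2 ^ L + i < p := by
    rw [show L + 2 = L + 1 + 1 by ring, add_mul _ 1, one_mul] at hp
    omega
  have hpb : p < 2 ^ b := (Nat.le_mul_self p).trans_lt hD.bound
  have hb2 : 2 < 2 ^ b := by omega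
  refine Does.mono (T := 38 + (37 + ((if (L + 1) * 2 ^ L + i ∈ K then 1 else 54 * k + 47) + 1 + 8)))
    ?_ (by split_ifs <;> omega) fun _ h => h
  refine .seq ((does_loadParameters hM hR _).mono le_rfl ?_)
  simp only [if_true, e0, e1, e2, e3, e4, e5, one_ne_zero, if_false]
  rintro ρ ⟨r0, r1, r2, r3, r4, r5, r6, r7, r9, r10⟩
  refine .seq (.seq (T := 1) (T' := 36) (.add (v := L + 1) (by rw [r6, r9]) (.seq (T := 1)
    (T' := 35) (.mul (v := (L + 1) * 2 ^ L) (by simp [r5]) (.seq (T := 1) (T' := 34)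
    (.add (v := (L + 1) * 2 ^ L + i) (by simp [r0]) ?_))))))
  refine (does_lookup hM hD (by simpa) (by simpa) (by simpa) (by simpa)).mono le_rfl ?_
  simp only [Function.update_self, Function.update_idem]
  rintro σ ⟨hσ, s15, s16⟩
  have hfr : ∀ r < 14, σ r = ρ r := fun r hr => by
    rw [hσ r hr, Function.update_of_ne (by omega)]
  refine .seq (Does.cond (P := (L + 1) * 2 ^ L + i ∈ K) ((Does.holds_eq ?_ ?_).trans ?_)
    (fun h => ?_) fun h => ?_)
  · rw [s15]; split_ifs <;> omega
  · rw [hfr 9 (by omega), r9]; omega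
  · rw [s15, hfr 9 (by omega), r9]; split_ifs with h <;> simp [h]
  · rw [if_pos h]
    exact .nop (does_report hM (hrk.trans hnR) hRb (by rw [hfr 1 (by omega), r1])
      (by rw [hfr 9 (by omega), r9]) (by rw [s16 h, hheavy h]))
  · rw [if_neg h]
    refine (does_searchRank hM hD ((Nat.mul_le_mul_right _ (by omega)).trans hp) hk hnR hnb strict
      hij hj htop hval hl hl' hrk hSb hS ?_ ?_ ?_ ?_ ?_ ?_ ?_ ?_ ?_ ?_).mono le_rfl
      fun τ h => does_report hM (hrk.trans hnR) hRb h.1 h.2.1 h.2.2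
    all_goals rw [hfr _ (by omega)]; assumption

end

/-! ### Building the data structure -/

theorem exists_layout {b : ℕ} (mem : ℕ → ℕ → ℕ) {R : ℕ} (hR : R * 8 ≤ 2 ^ b) :
    ∃ M : List (BitVec b), M.length = R * 8 ∧ Layout M mem R := by
  refine ⟨List.ofFn fun t : Fin (R * 8) => BitVec.ofNat b (mem (t % 8) (t / 8)), by simp,
    ⟨fun f hf r hr => ?_, hR⟩⟩
  rw [List.getElem?_ofFn, dif_pos (by omega)]
  simp only [Option.some.injEq]
  congr 2 <;> omega

open Classical in
theorem exists_dict {b p : ℕ} (hp : p.Prime) (hpb : p * p < 2 ^ b) (K : Finset ℕ)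
    (hK : ∀ x ∈ K, x < p) (hne : K.Nonempty) (hKb : 5 * K.card < 2 ^ b) (val : ℕ → ℕ) :
    ∃ (a : ℕ) (fields : ℕ → ℕ → ℕ), ∀ (mem : ℕ → ℕ → ℕ) (R : ℕ), 5 * K.card ≤ R →
      (∀ f, 1 ≤ f → f ≤ 5 → mem f = fields f) → IsDict b mem R p K.card a K val := by
  obtain ⟨a, mult, off, md, ha, hmult, hmd, hoff, hinj⟩ := exists_perfect_hash hp K hK hne
  have hN := hne.card_pos
  -- Unused slots hold `p`, which differs from every key that is looked up.
  let key : ℕ → ℕ := fun c =>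
    if h : ∃ x ∈ K, hashSlot p K.card a mult off md x = c then h.choose else p
  have hkey : ∀ x ∈ K, key (hashSlot p K.card a mult off md x) = x := by
    intro x hx
    have h : ∃ y ∈ K, hashSlot p K.card a mult off md y = hashSlot p K.card a mult off md x :=
      ⟨x, hx, rfl⟩
    simp only [key, dif_pos h]
    exact hinj h.choose_spec.1 hx h.choose_spec.2
  have hkey' : ∀ c, key c ∈ K ∨ key c = p := by
    intro c
    by_cases h : ∃ x ∈ K, hashSlot p K.card a mult off md x = c
    · left
      simp only [key, dif_pos h]
      exact h.choose_spec.1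
    · right
      simp only [key, dif_neg h]
  have hbucket : ∀ x, a * x % p % K.card < K.card := fun x => Nat.mod_lt _ hN
  refine ⟨a, fun f => match f with
    | 1 => mult | 2 => off | 3 => md | 4 => key | _ => fun c => val (key c), ?_⟩
  intro mem R hR hmem
  have m1 : mem 1 = mult := hmem 1 (by omega) (by omega)
  have m2 : mem 2 = off := hmem 2 (by omega) (by omega)
  have m3 : mem 3 = md := hmem 3 (by omega) (by omega)
  have m4 : mem 4 = key := hmem 4 (by omega) (by omega)
  have m5 : mem 5 = fun c => val (key c) := hmem 5 (by omega) (by omega)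
  refine ⟨ha, by omega, hpb, fun x => ?_, ?_, fun x => ?_, fun x => ?_, fun c => ?_, fun x hx => ?_,
    fun x hx => ?_⟩
  · have := hbucket x; omega
  · rwa [m1]
  · rw [m3]; have := hoff _ (hbucket x); omega
  · rw [m1, m2, m3]
    have h1 := hoff _ (hbucket x)
    have h2 := Nat.mod_lt (mult (a * x % p % K.card) * x % p) (hmd (a * x % p % K.card))
    simp only [hashSlot]
    omega
  · rw [m4]
    rcases hkey' c with h | h
    · exact (hK _ h).le
    · exact h.le
  · rw [m1, m2, m3, m4]
    refine ⟨fun h => ?_, hkey x⟩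
    rcases hkey' (hashSlot p K.card a mult off md x) with h' | h'
    · rwa [h] at h'
    · omega
  · rw [m1, m2, m3, m5]
    simp only [hkey x hx]

theorem exists_structure (strict : Bool) {U b : ℕ} (hU : 0 < U) (hb : (U + 2) ^ 10 ≤ 2 ^ b)
    (T A : Finset ℕ) (hT : ∀ x ∈ T, x < U) (hA : ∀ x ∈ A, x < U) :
    ∃ M : List (BitVec b), M.length ≤ 88 * T.card + 40 * A.card + 88 ∧ ∀ i < U,
      Does M (query strict) (fun r => if r = 0 then i else 0)
        (if i ∈ A then 85 else 54 * U.size.size + 131)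
        (Answers (Nat.nth (· ∈ T))
          (Nat.count (· ∈ T) (i + if strict then 0 else 1))) := by
  classical
  set L := U.size with hL
  set n := T.card with hn
  let rk : ℕ → ℕ := Nat.count (· ∈ T)
  let o : ℕ := if strict then 0 else 1
  have ho : o ≤ 1 := by simp only [o]; split_ifs <;> omega
  have hL0 : 0 < L := Nat.size_pos.mpr hU
  have hUL : U < 2 ^ L := Nat.lt_size_self U
  have hLU : 2 ^ L ≤ 2 * U := by
    have h1 : 2 ^ (L - 1) ≤ U := Nat.lt_size.mp (by omega)
    obtain ⟨l, hl⟩ : ∃ l, L = l + 1 := ⟨L - 1, by omega⟩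
    rw [hl] at h1 ⊢
    rw [pow_succ]
    simp only [Nat.add_sub_cancel] at h1
    omega
  have hLL : L < 2 ^ L := Nat.lt_two_pow_self
  have hnU : n ≤ U := by
    simpa using Finset.card_le_card (fun x hx => Finset.mem_range.mpr (hT x hx) : T ⊆ .range U)
  have hAU : A.card ≤ U := by
    simpa using Finset.card_le_card (fun x hx => Finset.mem_range.mpr (hA x hx) : A ⊆ .range U)
  have hg : Monotone fun j => rk j / L := fun i j hij =>
    Nat.div_le_div_right (Nat.count_monotone _ hij)
  have hrkn : ∀ j, rk j ≤ n := count_le_card T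
  set J := jumps (fun j => rk j / L) (2 ^ L) with hJ
  have hJ2 : ∀ r ∈ J, r < 2 ^ L := fun r hr =>
    (Finset.mem_Ico.mp (Finset.mem_filter.mp hr).1).2
  have hJcard : J.card ≤ n / L := card_jumps_le hg fun j => Nat.div_le_div_right (hrkn j)
  obtain ⟨val₀, hval₀⟩ := exists_trie_values hg L
  set K := trieKeys L J ∪ A.image fun i => (L + 1) * 2 ^ L + i with hK
  -- Keys below `(L + 1) * 2 ^ L` are trie nodes and hold coarse ranks scaled by `L`; those above
  -- are heavy points and hold exact ranks.
  let val : ℕ → ℕ := fun k =>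
    if k < (L + 1) * 2 ^ L then L * val₀ k else rk (k - (L + 1) * 2 ^ L + o)
  -- Each of the at most `n / L` jumps contributes `L + 1 ≤ 2 * L` prefixes: coarsening by `L` pays
  -- for the depth of the trie.
  have hKcard : K.card ≤ 2 * n + 1 + A.card := by
    have h1 : (L + 1) * (n / L) ≤ 2 * n := by
      calc (L + 1) * (n / L) ≤ 2 * L * (n / L) := Nat.mul_le_mul_right _ (by omega)
        _ = 2 * (L * (n / L)) := by ring
        _ ≤ 2 * n := Nat.mul_le_mul_left _ (Nat.mul_div_le _ _)
    have h2 := card_trieKeys_le L J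
    have h3 : (L + 1) * J.card ≤ (L + 1) * (n / L) := Nat.mul_le_mul_left _ hJcard
    have h4 : (A.image fun i => (L + 1) * 2 ^ L + i).card ≤ A.card := Finset.card_image_le
    have h5 : K.card ≤ _ := Finset.card_union_le _ _
    omega
  -- This will bound `p * p`, as `p ≤ 16 * (U + 2) ^ 2`. The exponent `10` absorbs the constant
  -- because `256 < 3 ^ 6` and `3 ≤ U + 2`.
  have hsize : 256 * (U + 2) ^ 4 < 2 ^ b := by
    refine lt_of_lt_of_le ?_ hb
    have h1 : 3 ^ 6 ≤ (U + 2) ^ 6 := Nat.pow_le_pow_left (by omega) 6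
    have h2 : 0 < (U + 2) ^ 4 := by positivity
    calc 256 * (U + 2) ^ 4 < 3 ^ 6 * (U + 2) ^ 4 := Nat.mul_lt_mul_of_pos_right (by norm_num) h2
      _ ≤ (U + 2) ^ 6 * (U + 2) ^ 4 := Nat.mul_le_mul_right _ h1
      _ = (U + 2) ^ 10 := by ring
  have hlin : 256 * (U + 2) < 2 ^ b :=
    (Nat.mul_le_mul_left _ (Nat.le_self_pow (by norm_num) _)).trans_lt hsize
  obtain ⟨p, hp, hp1, hp2⟩ := Nat.exists_prime_lt_and_le_two_mul ((L + 2) * 2 ^ L) (by positivity)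
  have hpb : p * p < 2 ^ b := by
    have h1 : p ≤ 16 * (U + 2) ^ 2 := by
      refine hp2.trans ?_
      calc 2 * ((L + 2) * 2 ^ L) ≤ 2 * (4 * (U + 2) * (2 * (U + 2))) := by
            gcongr <;> omega
        _ = 16 * (U + 2) ^ 2 := by ring
    calc p * p ≤ (16 * (U + 2) ^ 2) * (16 * (U + 2) ^ 2) := Nat.mul_le_mul h1 h1
      _ = 256 * (U + 2) ^ 4 := by ring
      _ < 2 ^ b := hsize
  have e2 : (L + 2) * 2 ^ L = (L + 1) * 2 ^ L + 2 ^ L := by ring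
  have hKp : ∀ x ∈ K, x < p := by
    intro x hx
    rcases Finset.mem_union.mp hx with h | h
    · have := lt_of_mem_trieKeys hJ2 h
      omega
    · obtain ⟨i, hi, rfl⟩ := Finset.mem_image.mp h
      have := hA i hi
      omega
  have hheavy : ∀ i, (L + 1) * 2 ^ L + i ∈ K ↔ i ∈ A := by
    intro i
    rw [hK, Finset.mem_union]
    constructor
    · rintro (h | h)
      · have := lt_of_mem_trieKeys hJ2 h
        omega
      · obtain ⟨i', hi, h⟩ := Finset.mem_image.mp h
        rwa [← Nat.add_left_cancel h]
    · exact fun h => .inr (Finset.mem_image_of_mem _ h)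
  have hKne : K.Nonempty :=
    ⟨_, Finset.mem_union_left _ (top_mem_trieKeys (j := 0) J (by positivity))⟩
  obtain ⟨a, fields, hdict⟩ := exists_dict hp hpb K hKp hKne (by omega) val
  -- Field `0` holds the parameters, fields `1` to `5` the hash table and field `6` the sorted
  -- elements.
  let mem : ℕ → ℕ → ℕ := fun f => match f with
    | 0 => fun r => [p, K.card, a, 2 ^ L, L, n].getD r 0
    | 6 => Nat.nth (· ∈ T)
    | f => fields f
  set R := 5 * K.card + 6 + n with hR
  obtain ⟨M, hMlen, hM⟩ := exists_layout (b := b) mem (R := R) (by omega)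
  have hD := hdict mem R (by omega) fun f h1 h5 => by
    interval_cases f <;> rfl
  refine ⟨M, by omega, fun i hi => ?_⟩
  have hj : i + o < 2 ^ L := by omega
  have hmod := Nat.div_add_mod (rk (i + o)) L
  have hmod' := Nat.mod_lt (rk (i + o)) hL0
  have key := does_query hM (by omega) (by omega) hD rfl rfl rfl rfl rfl rfl hp1.le
    (Nat.lt_size_self L) (by omega) (by omega) strict (n := n) (i := i) (j := i + o)
    (l := L * (rk (i + o) / L)) (rk := rk (i + o)) rfl hj
    (fun _ => by simp [val]) (Finset.mem_union_left _ (top_mem_trieKeys J hj))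
    (fun s hs hx => by
      have h1 : s * 2 ^ L + (i + o) >>> s < (L + 1) * 2 ^ L := by
        have h2 := (Nat.shiftRight_le (i + o) s).trans_lt hj
        have h3 : s * 2 ^ L ≤ L * 2 ^ L := Nat.mul_le_mul_right _ hs
        rw [add_mul, one_mul]
        omega
      simp only [val, if_pos h1]
      rw [hval₀ s hs _ hj (hx.imp_right fun h h' => h (Finset.mem_union_left _ h'))])
    (by omega) (by omega) (hrkn _)
    (fun m hm => by
      have h := (nth_lt_iff_lt_count (j := U) hm).mpr ?_
      · exact h.trans (by omega)
      · have : Nat.count (· ∈ T) U = n := by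
          rw [Nat.count_eq_card_filter_range, hn]
          congr 1
          ext x
          simpa using hT x
        omega)
    (fun m hm => nth_lt_iff_lt_count hm)
  simp only [hheavy] at key
  exact key

end WordRAM

/-! ### Logarithms and heavy points -/

theorem one_le_lg {x : ℝ} (hx : 0 ≤ x) : 1 ≤ lg x := by
  rw [lg, Real.le_logb_iff_rpow_le (by norm_num) (by linarith)]
  norm_num
  linarith

theorem logb_lt_lg {x : ℝ} (hx : 0 < x) : Real.logb 2 x < lg x :=
  Real.logb_lt_logb (by norm_num) hx (by linarith)

theorem size_le_logb_add_one {n : ℕ} (hn : 0 < n) : (n.size : ℝ) ≤ Real.logb 2 n + 1 := by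
  have h0 := Nat.size_pos.mpr hn
  have h1 : 2 ^ (n.size - 1) ≤ n := Nat.lt_size.mp (by omega)
  have h2 : ((n.size - 1 : ℕ) : ℝ) ≤ Real.logb 2 n := by
    rw [Real.le_logb_iff_rpow_le (by norm_num) (by exact_mod_cast hn), Real.rpow_natCast]
    exact_mod_cast h1
  rw [Nat.cast_sub h0] at h2
  push_cast at h2
  linarith

theorem size_size_le {U : ℕ} (hU : 0 < U) :
    (U.size.size : ℝ) ≤ Real.logb 2 (lg U) + 2 := by
  have hU' : (0 : ℝ) < U := by exact_mod_cast hU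
  have h1 := one_le_lg hU'.le
  have h2 : (U.size : ℝ) ≤ 2 * lg U := by
    have := size_le_logb_add_one hU
    have := logb_lt_lg hU'
    linarith
  have h0 := Nat.size_pos.mpr hU
  have h3 := size_le_logb_add_one h0
  have h4 : Real.logb 2 U.size ≤ Real.logb 2 (2 * lg U) :=
    Real.logb_le_logb_of_le (by norm_num) (by exact_mod_cast h0) h2
  rw [Real.logb_mul (by norm_num) (by linarith), Real.logb_self_eq_one (by norm_num)] at h4
  linarith

theorem card_heavy_le {ι : Type*} [Fintype ι] (w : ι → ℝ) (hw : ∀ i, 0 < w i) {B : ℝ}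
    (hB : 0 ≤ B) : ((Finset.univ.filter fun i => ∑ j, w j ≤ w i * B).card : ℝ) ≤ B := by
  rcases isEmpty_or_nonempty ι with h | h
  · simpa
  have hW : 0 < ∑ j, w j := Finset.sum_pos (fun i _ => hw i) Finset.univ_nonempty
  refine le_of_mul_le_mul_right ?_ hW
  rw [← nsmul_eq_mul]
  calc _ ≤ ∑ i ∈ Finset.univ.filter fun i => ∑ j, w j ≤ w i * B, w i * B :=
        Finset.card_nsmul_le_sum _ _ _ fun i hi => (Finset.mem_filter.mp hi).2
    _ ≤ ∑ i, w i * B := Finset.sum_le_sum_of_subset_of_nonneg (Finset.filter_subset _ _)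
        fun i _ _ => mul_nonneg (hw i).le hB
    _ = B * ∑ i, w i := by rw [← Finset.sum_mul, mul_comm]

/-! ### Predecessors in terms of ranks -/

theorem predecessor_eq_max_filter (strict : Bool) {U : ℕ} (S : Finset (Fin U)) (i : Fin U) :
    predecessor strict S i =
      (S.filter fun s : Fin U => (s : ℕ) < i + if strict then 0 else 1).max := by
  cases strict <;> simp [predecessor]

theorem exists_max_filter_eq {U : ℕ} (S : Finset (Fin U)) {j : ℕ}
    (hpos : 0 < Nat.count (· ∈ S.map Fin.valEmbedding) j) :
    ∃ s : Fin U, (S.filter fun s : Fin U => (s : ℕ) < j).max = s ∧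
      Nat.nth (· ∈ S.map Fin.valEmbedding) (Nat.count (· ∈ S.map Fin.valEmbedding) j - 1) = s := by
  set T := S.map Fin.valEmbedding with hT
  have hc := count_le_card T j
  set x := Nat.nth (· ∈ T) (Nat.count (· ∈ T) j - 1) with hx
  have hlt : ∀ m < T.card, Nat.nth (· ∈ T) m < j ↔ m < Nat.count (· ∈ T) j := fun m hm =>
    nth_lt_iff_lt_count hm
  have hxj : x < j := (hlt _ (by omega)).mpr (by omega)
  have hxT : x ∈ T := by
    refine Nat.nth_mem (p := (· ∈ T)) _ fun hf => ?_
    have : hf.toFinset = T := by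
      ext y
      rw [Set.Finite.mem_toFinset]
      rfl
    rw [this]
    omega
  obtain ⟨s, hs, hsx⟩ := Finset.mem_map.mp hxT
  refine ⟨s, ?_, hsx.symm⟩
  have hsx' : (s : ℕ) = x := hsx
  refine le_antisymm (Finset.max_le fun s' hs' => ?_)
    (Finset.le_max (Finset.mem_filter.mpr ⟨hs, by omega⟩))
  rw [Finset.mem_filter] at hs'
  rw [WithBot.coe_le_coe, Fin.le_def, hsx']
  -- If `s'` were larger than `x`, the rank of `s'` would lie strictly between the rank of `j` minus
  -- one and the rank of `j`.
  by_contra hlt'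
  have h1 : (s' : ℕ) ∈ T := Finset.mem_map_of_mem _ hs'.1
  have h2 : (x : ℕ) < Nat.nth (· ∈ T) (Nat.count (· ∈ T) s') := by
    rw [Nat.nth_count (p := (· ∈ T)) h1]; omega
  have h3 : Nat.count (· ∈ T) (s' : ℕ) < Nat.count (· ∈ T) j := by
    have := Nat.count_monotone (· ∈ T) (Nat.succ_le_of_lt hs'.2)
    rw [Nat.succ_eq_add_one, Nat.count_succ, if_pos h1] at this
    omega
  have h4 : Nat.count (· ∈ T) (x + 1) ≤ Nat.count (· ∈ T) (s' : ℕ) :=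
    Nat.count_monotone _ (by omega)
  have h5 := (nth_lt_iff_lt_count (T := T) (j := x + 1)
    (by omega : Nat.count (· ∈ T) j - 1 < T.card)).mp (by omega)
  omega

theorem max_filter_eq_bot {U : ℕ} (S : Finset (Fin U)) {j : ℕ}
    (h : Nat.count (· ∈ S.map Fin.valEmbedding) j = 0) :
    (S.filter fun s : Fin U => (s : ℕ) < j).max = ⊥ := by
  rw [Finset.max_eq_bot, Finset.filter_eq_empty_iff]
  intro s hs hlt
  rw [Nat.count_eq_card_filter_range, Finset.card_eq_zero, Finset.filter_eq_empty_iff] at h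
  exact h (Finset.mem_range.mpr hlt) (Finset.mem_map_of_mem Fin.valEmbedding hs)

theorem pow_le_two_pow {U b k : ℕ} (h : k * lg (U : ℝ) ≤ b) : (U + 2) ^ k ≤ 2 ^ b := by
  have hpos : (0 : ℝ) < (U : ℝ) + 2 := by positivity
  have h1 : ((U : ℝ) + 2) ^ k ≤ 2 ^ b := by
    rw [← Real.rpow_natCast 2 b, ← Real.logb_le_iff_le_rpow (by norm_num) (by positivity),
      Real.logb_pow]
    exact h
  exact_mod_cast h1

namespace WordRAM

theorem init_eq_enc (b i : ℕ) : init b i = enc b fun r => if r = 0 then i else 0 := by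
  funext r
  by_cases h : r = 0 <;> simp [init, enc, h]

theorem Answers.reports {b U : ℕ} (hUb : U < 2 ^ b) (strict : Bool) (S : Finset (Fin U))
    (i : Fin U) {ρ : ℕ → ℕ}
    (h : Answers (Nat.nth (· ∈ S.map Fin.valEmbedding))
      (Nat.count (· ∈ S.map Fin.valEmbedding) (i + if strict then 0 else 1)) ρ) :
    Reports (enc b ρ) (predecessor strict S i) := by
  rw [predecessor_eq_max_filter]
  have hi := i.isLt
  rcases Nat.eq_zero_or_pos (Nat.count (· ∈ S.map Fin.valEmbedding) (i + if strict then 0 else 1))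
    with h0 | h0
  · rw [max_filter_eq_bot S h0]
    simp [Reports, enc, h.1 h0]
  · obtain ⟨s, hs, hx⟩ := exists_max_filter_eq S h0
    obtain ⟨h1, h2⟩ := h.2 h0
    rw [hs]
    have hs' := s.isLt
    rw [hx] at h2
    refine ⟨?_, ?_⟩
    · simp [enc, h1, Nat.mod_eq_of_lt (by omega : 1 < 2 ^ b)]
    · simp [enc, h2, Nat.mod_eq_of_lt (by omega : (s : ℕ) < 2 ^ b)]

end WordRAM

/-! ### Light queries and the final count -/

theorem logb_lg_le_of_light {U : ℕ} {ε x : ℝ} (hε : 0 < ε)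
    (hx : (2 : ℝ) ^ (lg (U : ℝ) ^ ε) < x) :
    Real.logb 2 (lg U) ≤ 1 / ε * lg (lg x) := by
  have hU := one_le_lg (Nat.cast_nonneg U : (0 : ℝ) ≤ U)
  have hE : 0 < lg (U : ℝ) ^ ε := Real.rpow_pos_of_pos (by linarith) _
  have hx0 : 0 < x := lt_trans (by positivity) hx
  have h1 : lg (U : ℝ) ^ ε < lg x :=
    ((Real.lt_logb_iff_rpow_lt (by norm_num) hx0).mpr hx).trans (logb_lt_lg hx0)
  have h2 : Real.logb 2 (lg (U : ℝ) ^ ε) ≤ lg (lg x) :=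
    (Real.logb_le_logb_of_le (by norm_num) hE h1.le).trans (logb_lt_lg (hE.trans h1)).le
  rw [Real.logb_rpow_eq_mul_logb_of_pos (by linarith)] at h2
  rw [one_div, ← div_eq_inv_mul, le_div_iff₀ hε]
  linarith

theorem theorem3 (strict : Bool) :
    ∃ (P : WordRAM.Program) (k c : ℝ),
      ∀ (U b : ℕ), k * lg (U : ℝ) ≤ (b : ℝ) →
      ∀ (ε : ℝ), 0 < ε → ε < 1 →
      ∀ (S : Finset (Fin U)) (w : Fin U → ℝ), (∀ i, 0 < w i) →
      ∃ M : List (BitVec b),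
        (M.length : ℝ) ≤ c * ((S.card : ℝ) + (2 : ℝ) ^ (lg (U : ℝ) ^ ε)) ∧
        ∀ i : Fin U, ∃ (t : ℕ) (τ : WordRAM.Regs b),
          WordRAM.Exec M P (WordRAM.init b (i : ℕ)) t τ ∧
          (t : ℝ) ≤ c * ((1 / ε) * lg (lg ((∑ j, w j) / w i))) ∧
          WordRAM.Reports τ (predecessor strict S i) := by
  -- A light query takes at most `54 * (log log U + 2) + 131` steps, and `54 + 108 + 131 = 293`; the
  -- space constant `88 + 40` is smaller.
  refine ⟨WordRAM.query strict, (10 : ℕ), 293, fun U b hb ε hε hε1 S w hw => ?_⟩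
  set B : ℝ := (2 : ℝ) ^ (lg (U : ℝ) ^ ε) with hB
  rcases Nat.eq_zero_or_pos U with rfl | hU
  · exact ⟨[], by simp; positivity, fun i => i.elim0⟩
  have hpow := pow_le_two_pow hb
  have hUb : U < 2 ^ b := by
    have : U + 2 ≤ (U + 2) ^ 10 := Nat.le_self_pow (by norm_num) _
    omega
  have hlgU := one_le_lg (Nat.cast_nonneg U : (0 : ℝ) ≤ U)
  have hB1 : 1 ≤ B := Real.one_le_rpow (by norm_num) (Real.rpow_nonneg (by linarith) _)
  set A := Finset.univ.filter fun i => ∑ j, w j ≤ w i * B with hA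
  have hAB : (A.card : ℝ) ≤ B := card_heavy_le w hw (by linarith)
  have hval : ∀ (X : Finset (Fin U)), ∀ x ∈ X.map Fin.valEmbedding, x < U := by
    intro X x hx
    obtain ⟨y, -, rfl⟩ := Finset.mem_map.mp hx
    exact y.isLt
  obtain ⟨M, hlen, hM⟩ := WordRAM.exists_structure strict hU hpow (S.map Fin.valEmbedding)
    (A.map Fin.valEmbedding) (hval S) (hval A)
  rw [Finset.card_map, Finset.card_map] at hlen
  refine ⟨M, ?_, fun i => ?_⟩
  · have h1 : (M.length : ℝ) ≤ 88 * S.card + 40 * A.card + 88 := by exact_mod_cast hlen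
    have h2 : (0 : ℝ) ≤ S.card := Nat.cast_nonneg _
    linarith
  obtain ⟨t, ρ, hexec, ht, hans⟩ := hM i i.isLt
  refine ⟨t, WordRAM.enc b ρ, by rwa [WordRAM.init_eq_enc], ?_, hans.reports hUb strict S i⟩
  have hW : 0 < ∑ j, w j := Finset.sum_pos (fun i _ => hw i) ⟨i, Finset.mem_univ _⟩
  have hlg2 : 1 ≤ lg (lg ((∑ j, w j) / w i)) :=
    one_le_lg (zero_le_one.trans (one_le_lg (div_nonneg hW.le (hw i).le)))
  have hε' : 1 ≤ 1 / ε := by rw [le_div_iff₀ hε]; linarith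
  have hY : 1 ≤ 1 / ε * lg (lg ((∑ j, w j) / w i)) := one_le_mul_of_one_le_of_one_le hε' hlg2
  have hmem : (i : ℕ) ∈ A.map Fin.valEmbedding ↔ i ∈ A := Finset.mem_map' Fin.valEmbedding
  by_cases hi : i ∈ A
  · rw [if_pos (hmem.mpr hi)] at ht
    have : (t : ℝ) ≤ 85 := by exact_mod_cast ht
    linarith
  · rw [if_neg (mt hmem.mp hi)] at ht
    have h1 : (t : ℝ) ≤ 54 * U.size.size + 131 := by exact_mod_cast ht
    have h2 := size_size_le hU
    have h3 : B < (∑ j, w j) / w i := by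
      rw [lt_div_iff₀ (hw i), mul_comm]
      simpa [hA] using hi
    have h4 := logb_lg_le_of_light hε h3
    linarith
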